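/- **Equipments.** Let $A_0$ be a category. A *module* $A$ on $A_0$ is a pseudofunctor $A:A_0^{\mathrm{op}}\times A_0\to\mathbf{Cat}$; the objects $a:x\nrightarrow y$ of $A(x,y)$ are called *vectors*, its morphisms *2-cells*, and the morphisms of $A_0$ *scalars*. For scalars $f,g$ write $af=A(f,y)(a)$ and $ga=A(x,g)(a)$. A *cell* from $a:x\nrightarrow y$ to $b:x'\nrightarrow y'$ with boundary scalars $f:x\to x'$ and $g:y\to y'$ is a 2-cell $ga\Rightarrow bf$; it is *invertible* if this 2-cell is. An *equipment* $\mathbb A=(A_0,A,P,\xi)$ consists of a category $A_0$, a module $A$ on it, composition functors $$P_{x_0,\dots,x_n}:A(x_0,x_1)\times\cdots\times A(x_{n-1},x_n)\to A(x_0,x_n),\qquad (a_1,\dots,a_n)\mapsto a_n\cdots a_1\qquad(n\ge 0)$$ that are pseudonatural in $x_0,x_n$ and pseudo-dinatural in $x_1,\dots,x_{n-1}$, with $P_{x,y}=\mathrm{id}$; for $n=0$ these are the identity vectors $i_x:x\nrightarrow x$, with coherent isomorphisms $f i_x\cong i_y f$ for scalars $f:x\to y$. There is also a lax associator $\xi$: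 for each partition $n=n_1+\cdots+n_k$ ($n_j\ge0$) a modification with components 2-cells $$a_n\cdots a_1\Rightarrow (\text{composite of the }k\text{ composites of consecutive blocks of lengths }n_1,\dots,n_k),$$ which is the identity for the partitions $n=n$ and $n=1+\cdots+1$ and is associative: for a twice nested partition the two resulting 2-cells to the threefold nested composite agree. A *functor of equipments* $(F_0,F,\kappa):\mathbb A\to\mathbb B$ consists of a functor $F_0:A_0\to B_0$, functors $A(x,y)\to B(F_0x,F_0y)$ pseudonatural in $x,y$, and 2-cells $\kappa_{a_1,\dots,a_n}:Fa_n\cdots Fa_1\Rightarrow F(a_n\cdots a_1)$ that are natural (also with respect to scalars), equal to the identity for $n=1$, and compatible with the associators. A *transformation* $(t,\nu):F\to G$ consists of a natural transformation $t:F_0\to G_0$ and cells $\nu_a$ from $Fa$ to $Ga$ with boundaries $t_x,t_y$, i.e. 2-cells $t_y\,Fa\Rightarrow Ga\,t_x$, natural with respect to all cells and compatible with $\kappa^F$ and $\kappa^G$. A *$T$-equipment* $(\mathbb T_0,\mathbb A)=(\mathbb T_0,\mathbb A,T,\kappa,\nu^m,\nu^e)$ consists of an equipment $\mathbb A$, a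 monad $\mathbb T_0=(T_0,m,e)$ on $A_0$, and a lift of it to a monad on $\mathbb A$ in the 2-category of equipments, functors and transformations, with functor part $(T_0,T,\kappa)$, multiplication $(m,\nu^m)$ and unit $(e,\nu^e)$. Thus $\nu^m_a:m_y\,T^2a\Rightarrow Ta\,m_x$ and $\nu^e_a:e_y\,a\Rightarrow Ta\,e_x$. **Stars.** A *$\ast$-module* is a module with a chosen right adjoint $a\mapsto g^\ast a$ of each functor $a\mapsto ga$ and a chosen left adjoint $a\mapsto af^\ast$ of each functor $a\mapsto af$, such that the mates $(ka)f^\ast\Rightarrow k(af^\ast)$ and $(g^\ast a)l\Rightarrow g^\ast(al)$ of the structural isomorphisms are invertible, and the two transformations $(g^\ast a)f^\ast\Rightarrow g^\ast(af^\ast)$ obtained as mates of their inverses are equal and invertible. A *$T$-$\ast$-equipment* is a $T$-equipment with a $\ast$-module structure on $A$ such that the functors $P$ (for $n\ge1$) and $T$ are also pseudonatural, respectively pseudo-dinatural in inner objects, when $A$ is regarded as a module on $A_0^{\mathrm{op}}$ through the opactions $a\mapsto g^\ast a$, $a\mapsto af^\ast$; here the structural isomorphisms are the canonical ones, i.e.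 whenever cells $ga\Rightarrow bf$ have invertible mates $af^\ast\Rightarrow g^\ast b$, so do their horizontal composites and their images under $T$. **Monoids and algebras.** A *monoid* in $\mathbb A$ is $(x,a,\mu,\eta)$ with $a:x\nrightarrow x$ and 2-cells $\mu:aa\Rightarrow a$, $\eta:i_x\Rightarrow a$ such that $\mu\circ(\mu a)\circ\xi=\mu\circ(a\mu)\circ\xi:aaa\Rightarrow a$ and $\mu\circ(\eta a)\circ\xi=1_a=\mu\circ(a\eta)\circ\xi$, with the appropriate components of $\xi$. A homomorphism $(x,a)\to(y,b)$ is a pair $(f,\phi)$ of a scalar $f:x\to y$ and a 2-cell $\phi:fa\Rightarrow bf$ compatible with multiplications and units. The given monad on $\mathbb A$ induces a monad $\mathsf T$ on the category $\mathrm{Mon}(\mathbb A)$, with $\mathsf T(x,a,\mu,\eta)=(T_0x,Ta,T\mu\circ\kappa_{a,a},T\eta\circ\kappa_x)$, multiplication $(m_x,\nu^m_a)$ and unit $(e_x,\nu^e_a)$. The category $T\text{-}\mathrm{Alg}(\mathbb T_0,\mathbb A)$ of *$T$-algebras* is the category of Eilenberg–Moore algebras of $\mathsf T$; a $T$-algebra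 is thus a monoid $(x,b)$ with a monoid homomorphism $(h,\sigma):(T_0x,Tb)\to(x,b)$ satisfying the algebra laws. A *$T$-monoid* (a monoid in the Kleisli equipment of $(\mathbb T_0,\mathbb A)$, whose vectors $x\nrightarrow y$ are the vectors $x\nrightarrow T_0y$ of $\mathbb A$) is $(x,a,\mu,\eta)$ with $a:x\nrightarrow T_0x$ and 2-cells $\mu:m_x\,(Ta)\,a\Rightarrow a$, $\eta:e_x\,i_x\Rightarrow a$ satisfying (up to structural isomorphisms of scalar actions) $$\mu\circ(\nu^m_a\ast\mu)\circ\xi_{2+1}=\mu\circ\big((T\mu\circ\kappa_{a,Ta})\ast a\big)\circ\xi_{1+2},\qquad \mu\circ(\nu^e_a\ast\eta)\circ\xi_{0+1}=1_a=\mu\circ\big((T\eta\circ\kappa_x)\ast a\big)\circ\xi_{1+0}$$ as 2-cells out of the composite $(T^2a)(Ta)a$ (with the scalar $m_x\,T_0m_x=m_x\,m_{T_0x}$ applied), and out of $a$, respectively, where $\ast$ is horizontal composition of cells. A homomorphism $(x,a)\to(y,b)$ is a pair $(f,\phi)$ with $f:x\to y$ and $\phi:(T_0f)a\Rightarrow bf$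 compatible with multiplications and units. They form a category $T\text{-}\mathrm{Mon}(\mathbb T_0,\mathbb A)$. **The functors.** Let $\nu^m$ be invertible, i.e. let each $\nu^m_a:m_y\,T^2a\Rightarrow Ta\,m_x$ be an isomorphism. The *free $T$-algebra functor* $\mathcal M:T\text{-}\mathrm{Mon}(\mathbb T_0,\mathbb A)\to T\text{-}\mathrm{Alg}(\mathbb T_0,\mathbb A)$ sends $(x,a,\mu,\eta)$ to the monoid $(T_0x,\,m_x\,Ta)$ with multiplication $$m_x(Ta)m_x(Ta)\xrightarrow{(\nu^m_a)^{-1}}m_x m_{T_0x}(T^2a)(Ta)=m_x (T_0m_x)(T^2a)(Ta)\xrightarrow{\ \kappa_{a,Ta}\text{ and }T\mu\ }m_x\,Ta$$ and unit $i_{T_0x}\xrightarrow{\kappa_x}T i_x\cong m_x(T_0e_x)Ti_x\xrightarrow{T\eta}m_x\,Ta$, with the $T$-algebra structure whose scalar is $m_x$ and whose 2-cell is $m_x\,T(m_x\,Ta)\cong m_x\,m_{T_0x}\,T^2a\xrightarrow{\nu^m_a}m_x\,(Ta)\,m_x$; and $\mathcal M(f,\phi)$ is $T_0f$ with the 2-cell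 induced by $T\phi$. The *underlying $T$-monoid functor* $\mathcal K:T\text{-}\mathrm{Alg}(\mathbb T_0,\mathbb A)\to T\text{-}\mathrm{Mon}(\mathbb T_0,\mathbb A)$ sends $(x,b,h,\sigma)$ to $(x,h^\ast b)$, where, with $c:h\,h^\ast b\Rightarrow b$ the counit, the multiplication is the mate (along the factorization $h\,T_0h=h\,m_x$) of the cell obtained by composing $c$ horizontally with $\sigma\circ Tc$ and then applying the multiplication of $b$, and the unit is the mate (along $1_x=h\,e_x$) of the unit of $b$; and $\mathcal K(f,\phi)$ is $f$ with the mate of $\phi\circ c$ along $f h=h'\,T_0f$. **Theorem.** Let $(\mathbb T_0,\mathbb A,T,\kappa,\nu^m,\nu^e)$ be a $T$-$\ast$-equipment such that $\nu^m$ is invertible. Then $\mathcal M$ is left adjoint to $\mathcal K$. There is such an adjunction $\mathcal M\dashv\mathcal K$ whose unit at a $T$-monoid $(x,a)$ is $(e_x,\phi_{e_x}):(x,a)\to\mathcal K\mathcal M(x,a)=(T_0x,\,m_x^\ast m_x\,Ta)$, where $\phi_{e_x}$ is the mate, along the identity $m_x\,T_0e_x=m_x\,e_{T_0x}$, of $$m_x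 e_{T_0x}\,a\xrightarrow{\ \nu^e_a\ }m_x\,(Ta)\,e_x,$$ and whose counit at a $T$-algebra $(x,b,h,\sigma)$ is $(h,\phi_h):\mathcal M\mathcal K(x,b,h,\sigma)=(T_0x,\,m_x\,T(h^\ast b))\to(x,b)$, where $$\phi_h:\ h\,m_x\,T(h^\ast b)=h\,(T_0h)\,T(h^\ast b)\xrightarrow{\ Tc\ }h\,Tb\xrightarrow{\ \sigma\ }b\,h .$$ -/

import Mathlib

open CategoryTheory Opposite

universe v₁ u₁ w t v u

namespace TEq

section Push
variable {I : Type u} [Category.{v} I] (F : Pseudofunctor (LocallyDiscrete I) Cat.{v₁, u₁})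

/-- The category assigned to `i` by a pseudofunctor `F : I ⥤ Cat`. -/
abbrev Fib (i : I) : Type u₁ := F.obj ⟨i⟩
/-- The functor assigned to a morphism by a pseudofunctor. -/
abbrev act {i j : I} (u : i ⟶ j) : Fib F i ⥤ Fib F j := (F.map u.toLoc).toFunctor

/-- The unit isomorphism of a pseudofunctor. -/
def actId {i : I} (u : i ⟶ i) (hu : u = 𝟙 i) : act F u ≅ 𝟭 (Fib F i) :=
  Cat.Hom.toNatIso (F.mapId' u.toLoc (by subst hu; rfl))

/-- The composition isomorphism of a pseudofunctor. -/
def actComp {i j k : I} (u : i ⟶ j) (v : j ⟶ k) (w : i ⟶ k) (h : u ≫ v = w) :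
    act F w ≅ act F u ⋙ act F v :=
  Cat.Hom.toNatIso (F.mapComp' u.toLoc v.toLoc w.toLoc (by subst h; rfl))

lemma actId_naturality {i : I} (u : i ⟶ i) (hu : u = 𝟙 i) {a b : Fib F i} (α : a ⟶ b) :
    (act F u).map α ≫ (actId F u hu).hom.app b = (actId F u hu).hom.app a ≫ α :=
  (actId F u hu).hom.naturality α

lemma actComp_naturality {i j k : I} (u : i ⟶ j) (v : j ⟶ k) (w : i ⟶ k) (h : u ≫ v = w)
    {a b : Fib F i} (α : a ⟶ b) :
    (act F w).map α ≫ (actComp F u v w h).hom.app b =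
      (actComp F u v w h).hom.app a ≫ (act F v).map ((act F u).map α) :=
  (actComp F u v w h).hom.naturality α

lemma actComp_assoc {i j k l : I} (u : i ⟶ j) (v : j ⟶ k) (w : k ⟶ l) (uv : i ⟶ k) (vw : j ⟶ l)
    (t : i ⟶ l) (h₁ : u ≫ v = uv) (h₂ : v ≫ w = vw) (h₃ : uv ≫ w = t) (h₄ : u ≫ vw = t)
    (a : Fib F i) :
    (actComp F uv w t h₃).hom.app a ≫ (act F w).map ((actComp F u v uv h₁).hom.app a) =
      (actComp F u vw t h₄).hom.app a ≫ (actComp F v w vw h₂).hom.app ((act F u).obj a) := by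
  subst h₁ h₂ h₃
  exact (F.mapComp'₀₁₃_hom_comp_whiskerLeft_mapComp'_hom_app u.toLoc v.toLoc w.toLoc
    (u ≫ v).toLoc (v ≫ w).toLoc ((u ≫ v) ≫ w).toLoc rfl rfl
    (congrArg Quiver.Hom.toLoc h₄) a).symm

lemma actComp_id {i j : I} (u : i ⟶ j) (s : j ⟶ j) (hs : s = 𝟙 j) (h) (a : Fib F i) :
    (actComp F u s u h).hom.app a = (actId F s hs).inv.app ((act F u).obj a) := by
  subst hs
  refine (F.mapComp'_comp_id_hom_app u.toLoc a).trans ?_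
  exact congrArg (fun e : F.map (𝟙 (LocallyDiscrete.mk j)) ≅ 𝟙 _ => e.inv.toNatTrans.app _)
    (F.mapId'_eq_mapId ⟨j⟩).symm

lemma actId_comp {i j : I} (s : i ⟶ i) (hs : s = 𝟙 i) (u : i ⟶ j) (h) (a : Fib F i) :
    (actComp F s u u h).hom.app a = (act F u).map ((actId F s hs).inv.app a) := by
  subst hs
  refine (F.mapComp'_id_comp_hom_app u.toLoc a).trans ?_
  exact congrArg (fun e : F.map (𝟙 (LocallyDiscrete.mk i)) ≅ 𝟙 _ =>
    (act F u).map (e.inv.toNatTrans.app a)) (F.mapId'_eq_mapId ⟨i⟩).symm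

variable {F}

/-- Transport of a morphism `u a ⟶ v b` along `s`, up to the structural isomorphisms:
the morphism `(u ≫ s) a ≅ s (u a) ⟶ s (v b) ≅ (v ≫ s) b`. -/
def push {i j k l : I} {u : i ⟶ k} {v : j ⟶ k} {a : Fib F i} {b : Fib F j}
    (φ : (act F u).obj a ⟶ (act F v).obj b) (s : k ⟶ l) (us : i ⟶ l) (vs : j ⟶ l)
    (hu : u ≫ s = us) (hv : v ≫ s = vs) : (act F us).obj a ⟶ (act F vs).obj b :=
  (actComp F u s us hu).hom.app a ≫ (act F s).map φ ≫ (actComp F v s vs hv).inv.app b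

lemma push_id {i j k : I} {u : i ⟶ k} {v : j ⟶ k} {a : Fib F i} {b : Fib F j}
    (φ : (act F u).obj a ⟶ (act F v).obj b) (s : k ⟶ k) (hs : s = 𝟙 k) (h h') :
    push φ s u v h h' = φ := by
  unfold push
  have h0 := actId_naturality F s hs φ
  have h1 := actComp_id F u s hs h a
  have h2 := actComp_id F v s hs h' b
  have h3 : (actComp F v s v h').inv.app b = (actId F s hs).hom.app ((act F v).obj b) := by
    rw [← cancel_epi ((actComp F v s v h').hom.app b), Iso.hom_inv_id_app, h2,
      Iso.inv_hom_id_app]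
    rfl
  rw [h1, h3, h0, Iso.inv_hom_id_app_assoc]

lemma push_comp {i j m k l : I} {u : i ⟶ k} {v : j ⟶ k} {w : m ⟶ k} {a : Fib F i} {b : Fib F j}
    {c : Fib F m}
    (φ : (act F u).obj a ⟶ (act F v).obj b) (ψ : (act F v).obj b ⟶ (act F w).obj c)
    (s : k ⟶ l) (us : i ⟶ l) (vs : j ⟶ l) (ws : m ⟶ l)
    (hu : u ≫ s = us) (hv : v ≫ s = vs) (hw : w ≫ s = ws) :
    push (φ ≫ ψ) s us ws hu hw = push φ s us vs hu hv ≫ push ψ s vs ws hv hw := by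
  simp [push]

lemma push_push {i j k l m : I} {u : i ⟶ k} {v : j ⟶ k} {a : Fib F i} {b : Fib F j}
    (φ : (act F u).obj a ⟶ (act F v).obj b) (s : k ⟶ l) (us : i ⟶ l) (vs : j ⟶ l)
    (hu : u ≫ s = us) (hv : v ≫ s = vs) (t : l ⟶ m) (ut : i ⟶ m) (vt : j ⟶ m)
    (hut : us ≫ t = ut) (hvt : vs ≫ t = vt) (st : k ⟶ m) (hst : s ≫ t = st)
    (h1 : u ≫ st = ut) (h2 : v ≫ st = vt) :
    push (push φ s us vs hu hv) t ut vt hut hvt = push φ st ut vt h1 h2 := by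
  unfold push
  have ha := actComp_assoc F u s t us st ut hu hst hut h1 a
  have hb := actComp_assoc F v s t vs st vt hv hst hvt h2 b
  have hn := actComp_naturality F s t st hst φ
  rw [← cancel_mono ((actComp F vs t vt hvt).hom.app b ≫
    (act F t).map ((actComp F v s vs hv).hom.app b))]
  simp only [Category.assoc]
  rw [Iso.inv_hom_id_app_assoc, ← Functor.map_comp, Category.assoc, Category.assoc,
    Iso.inv_hom_id_app, hb, Iso.inv_hom_id_app_assoc, hn, ← reassoc_of% ha, ← Functor.map_comp]
  simp

lemma push_id_right {i k l : I} {u : i ⟶ k} {a : Fib F i} (s : k ⟶ l) (us : i ⟶ l)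
    (hu : u ≫ s = us) : push (𝟙 ((act F u).obj a)) s us us hu hu = 𝟙 _ := by
  simp [push]

instance push_isIso {i j k l : I} {u : i ⟶ k} {v : j ⟶ k} {a : Fib F i} {b : Fib F j}
    (φ : (act F u).obj a ⟶ (act F v).obj b) [IsIso φ] (s : k ⟶ l) (us : i ⟶ l) (vs : j ⟶ l)
    (hu : u ≫ s = us) (hv : v ≫ s = vs) : IsIso (push φ s us vs hu hv) := by
  unfold push; infer_instance

end Push

/-- A module from the category `C` to itself: a pseudofunctor `Cᵒᵖ × C ⥤ Cat`. Objects of its value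
at `(x, y)` are the vectors from `x` to `y`, the morphisms of that category are the 2-cells, and
morphisms of `C` are called scalars. -/
abbrev Mod (C : Type u) [Category.{v} C] :=
  Pseudofunctor (LocallyDiscrete (Cᵒᵖ × C)) Cat.{v₁, u₁}

section Cells

variable {C : Type u} [Category.{v} C] (A : Mod.{v₁, u₁} C)

/-- The category of vectors from `x` to `y`. -/
abbrev Vec (x y : C) : Type u₁ := Fib A (op x, y)

/-- The scalar `f`, acting on the source of vectors by `act A (pre f y)` (written `a f`). -/
abbrev pre {x' x : C} (f : x' ⟶ x) (y : C) : (op x, y) ⟶ (op x', y) := (f.op, 𝟙 y)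
/-- The scalar `g`, acting on the target of vectors by `act A (post x g)` (written `g a`). -/
abbrev post (x : C) {y y' : C} (g : y ⟶ y') : (op x, y) ⟶ (op x, y') := (𝟙 (op x), g)

variable {A}

/-- A cell with vertical boundaries the scalars `f : x ⟶ x'` and `g : y ⟶ y'`, from a vector
`a : x ⇸ y` to a vector `b : x' ⇸ y'`: a 2-cell `g a ⟶ b f`. -/
@[ext]
structure Cell {x x' y y' : C} (f : x ⟶ x') (g : y ⟶ y') (a : Vec A x y) (b : Vec A x' y') :
    Type v₁ where
  hom : (act A (post x g)).obj a ⟶ (act A (pre f y')).obj b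

namespace Cell
variable {x x' x'' x₃ y y' y'' y₃ : C} {f : x ⟶ x'} {g : y ⟶ y'} {f' : x' ⟶ x''} {g' : y' ⟶ y''}
  {f'' : x'' ⟶ x₃} {g'' : y'' ⟶ y₃}
  {a : Vec A x y} {b : Vec A x' y'} {c : Vec A x'' y''} {d : Vec A x₃ y₃}

/-- Vertical composition of cells, with the scalar boundaries given up to equality. -/
def compAux (φ : Cell f g a b) (ψ : Cell f' g' b c) (h : x ⟶ x'') (k : y ⟶ y'')
    (hh : f ≫ f' = h) (hk : g ≫ g' = k) : Cell h k a c :=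
  ⟨push φ.hom (post x g') (post x k) (f.op, g') (by simp [hk]) (by simp) ≫
    push ψ.hom (pre f y'') (f.op, g') (pre h y'') (by simp) (by simp [← hh])⟩

/-- Vertical composition of cells. -/
def comp (φ : Cell f g a b) (ψ : Cell f' g' b c) : Cell (f ≫ f') (g ≫ g') a c :=
  compAux φ ψ _ _ rfl rfl

/-- The identity cell. -/
def id (a : Vec A x y) : Cell (𝟙 x) (𝟙 y) a a := ⟨𝟙 _⟩

lemma id_compAux (φ : Cell f g a b) (h h') : compAux (id a) φ f g h h' = φ := by
  ext
  have h1 := push_id φ.hom (pre (𝟙 x) y') rfl (by simp) (by simp)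
  have h2 := push_id_right (F := A) (u := post x (𝟙 y)) (a := a) (post x g) (post x g) (by simp)
  exact (congrArg₂ (· ≫ ·) h2 h1).trans (Category.id_comp _)

lemma compAux_id (φ : Cell f g a b) (h h') : compAux φ (id b) f g h h' = φ := by
  ext
  have h1 := push_id φ.hom (post x (𝟙 y')) rfl (by simp) (by simp)
  have h2 := push_id_right (F := A) (u := post x' (𝟙 y')) (a := b) (pre f y') (pre f y') (by simp)
  exact (congrArg₂ (· ≫ ·) h1 h2).trans (Category.comp_id _)

lemma compAux_assoc (φ : Cell f g a b) (ψ : Cell f' g' b c) (χ : Cell f'' g'' c d)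
    (p : x ⟶ x'') (q : y ⟶ y'') (r : x' ⟶ x₃) (s : y' ⟶ y₃) (t : x ⟶ x₃) (u : y ⟶ y₃)
    (hp : f ≫ f' = p) (hq : g ≫ g' = q) (hr : f' ≫ f'' = r) (hs : g' ≫ g'' = s)
    (ht : p ≫ f'' = t) (hu : q ≫ g'' = u) (ht' : f ≫ r = t) (hu' : g ≫ s = u) :
    compAux (compAux φ ψ p q hp hq) χ t u ht hu = compAux φ (compAux ψ χ r s hr hs) t u ht' hu' := by
  ext
  unfold compAux
  dsimp only
  rw [push_comp _ _ _ _ (f.op, g' ≫ g'') _ (by simp [← hq, ← hu]) (by simp) (by simp),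
    push_comp _ _ _ _ ((f ≫ f').op, g'') _ (by simp [← hs]) (by simp) (by simp [← hr, ← ht']),
    push_push (st := post x (g' ≫ g'')) (hst := by simp) (h1 := by simp [← hu, ← hq])
      (h2 := by simp),
    push_push (st := (f.op, g'')) (hst := by simp) (h1 := by simp) (h2 := by simp [← hp]),
    push_push (us := post x' s) (st := (f.op, g'')) (hst := by simp) (h1 := by simp [hs])
      (h2 := by simp),
    push_push (st := pre (f ≫ f') y₃) (hst := by simp) (h1 := by simp)
      (h2 := by simp [← ht', ← hr])]
  subst hs hp
  simp

/-- The same cell with its scalar boundaries replaced by equal ones. -/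
def copy (φ : Cell f g a b) {h : x ⟶ x'} {k : y ⟶ y'} (hh : f = h) (hk : g = k) : Cell h k a b :=
  hk ▸ hh ▸ φ

end Cell

/-- The vectors with arbitrary end points; they are the objects of a category with the cells as
morphisms. -/
structure Tot (A : Mod.{v₁, u₁} C) where
  {src : C}
  {tgt : C}
  vec : Vec A src tgt

namespace Tot

/-- A morphism of `Tot A`: a cell with arbitrary scalar boundaries. -/
structure Hom (X Y : Tot A) where
  left : X.src ⟶ Y.src
  right : X.tgt ⟶ Y.tgt
  cell : Cell left right X.vec Y.vec

lemma Hom.mk_compAux {X Y Z : Tot A} {f : X.src ⟶ Y.src} {g : X.tgt ⟶ Y.tgt}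
    {f' : Y.src ⟶ Z.src} {g' : Y.tgt ⟶ Z.tgt} (φ : Cell f g X.vec Y.vec)
    (ψ : Cell f' g' Y.vec Z.vec) (h k hh hk) :
    Hom.mk h k (Cell.compAux φ ψ h k hh hk) = Hom.mk (f ≫ f') (g ≫ g') (φ.comp ψ) := by
  subst hh hk; rfl

instance : Category (Tot A) where
  Hom := Hom
  id X := ⟨𝟙 _, 𝟙 _, Cell.id X.vec⟩
  comp φ ψ := ⟨φ.left ≫ ψ.left, φ.right ≫ ψ.right, φ.cell.comp ψ.cell⟩
  id_comp φ := by
    rw [← Hom.mk_compAux _ _ φ.left φ.right (by simp) (by simp), Cell.id_compAux]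
  comp_id φ := by
    rw [← Hom.mk_compAux _ _ φ.left φ.right (by simp) (by simp), Cell.compAux_id]
  assoc φ ψ χ := by
    rw [← Hom.mk_compAux _ _ (φ.left ≫ ψ.left ≫ χ.left) (φ.right ≫ ψ.right ≫ χ.right)
      (by simp) (by simp)]
    exact congrArg (Hom.mk _ _) (Cell.compAux_assoc _ _ _ _ _ _ _ _ _ rfl rfl rfl rfl _ _ rfl rfl)

end Tot

namespace Cell
variable {x x' x'' x₃ y y' y'' y₃ : C} {f : x ⟶ x'} {g : y ⟶ y'} {f' : x' ⟶ x''} {g' : y' ⟶ y''}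
  {f'' : x'' ⟶ x₃} {g'' : y'' ⟶ y₃}
  {a : Vec A x y} {b : Vec A x' y'} {c : Vec A x'' y''} {d : Vec A x₃ y₃}

/-- A cell as a morphism of `Tot A`. Equations between pastings of cells are stated in `Tot A`, where
the scalar boundaries are part of the morphism (and so are equated as well). -/
def tot (φ : Cell f g a b) : Tot.mk a ⟶ Tot.mk b := Tot.Hom.mk f g φ

lemma tot_inj {φ ψ : Cell f g a b} (h : φ.tot = ψ.tot) : φ = ψ :=
  eq_of_heq (Tot.Hom.mk.inj h).2.2

lemma tot_copy (φ : Cell f g a b) {h : x ⟶ x'} {k : y ⟶ y'} (hh : f = h) (hk : g = k) :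
   (φ.copy hh hk).tot = φ.tot := by subst hh hk; rfl
lemma tot_comp  (φ : Cell f g a b) (ψ : Cell f' g' b c) : (φ.comp ψ).tot = φ.tot ≫ ψ.tot := rfl
lemma tot_id  (a : Vec A x y) : (Cell.id a).tot = 𝟙 _ := rfl

lemma tot_compAux (φ : Cell f g a b) (ψ : Cell f' g' b c) (h k hh hk) :
    (compAux φ ψ h k hh hk).tot = φ.tot ≫ ψ.tot := Tot.Hom.mk_compAux (X := .mk a) (Y := .mk b)
      (Z := .mk c) φ ψ h k hh hk

lemma id_left_compAux {x y y' y'' x'' : C} {g : y ⟶ y'} {f' : x ⟶ x''} {g' : y' ⟶ y''}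
    {a : Vec A x y} {b : Vec A x y'} {c : Vec A x'' y''} (φ : Cell (𝟙 x) g a b)
    (ψ : Cell f' g' b c) (k : y ⟶ y'') (hk : g ≫ g' = k) :
    (compAux φ ψ f' k (by simp) hk).hom =
      push φ.hom (post x g') (post x k) (post x g') (by simp [hk]) (by simp) ≫ ψ.hom := by
  have h2 := push_id ψ.hom (pre (𝟙 x) y'') rfl (by simp) (by simp)
  exact congrArg₂ (· ≫ ·) rfl h2

/-- A 2-cell of the module, as a cell with identity scalar boundaries. -/
def ofHom {a b : Vec A x y} (α : a ⟶ b) : Cell (𝟙 x) (𝟙 y) a b :=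
  ⟨(act A (post x (𝟙 y))).map α⟩

lemma tot_ofHom_comp {a b c : Vec A x y} (α : a ⟶ b) (β : b ⟶ c) :
    (ofHom (α ≫ β)).tot = (ofHom α).tot ≫ (ofHom β).tot := by
  rw [← tot_compAux _ _ (𝟙 x) (𝟙 y) (by simp) (by simp)]
  congr 1
  ext
  rw [id_left_compAux]
  have h2 := push_id (ofHom α).hom (post x (𝟙 y)) rfl (by simp) (by simp)
  exact ((act A (post x (𝟙 y))).map_comp α β).trans (congrArg (· ≫ (ofHom β).hom) h2).symm

lemma tot_ofHom_id (a : Vec A x y) : (ofHom (𝟙 a)).tot = 𝟙 _ :=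
  congrArg (fun t => tot (f := 𝟙 x) (g := 𝟙 y) (a := a) (b := a) ⟨t⟩)
    ((act A (post x (𝟙 y))).map_id a)

lemma tot_ofHom_eqToHom {a b : Vec A x y} (h : a = b) :
    (ofHom (eqToHom h)).tot = eqToHom (by rw [h]) := by
  subst h; exact tot_ofHom_id a

/-- A cell with identity scalar boundaries, as a 2-cell of the module. -/
def toHom {a b : Vec A x y} (φ : Cell (𝟙 x) (𝟙 y) a b) : a ⟶ b :=
  (actId A (post x (𝟙 y)) rfl).inv.app a ≫ φ.hom ≫ (actId A (pre (𝟙 x) y) rfl).hom.app b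

lemma ofHom_toHom {a b : Vec A x y} (φ : Cell (𝟙 x) (𝟙 y) a b) : ofHom (toHom φ) = φ := by
  have h := actId_naturality A (post x (𝟙 y)) rfl (toHom φ)
  ext
  rw [← cancel_mono ((actId A (pre (𝟙 x) y) rfl).hom.app b)]
  refine h.trans ?_
  simp [toHom]

/-- A cell is invertible when the 2-cell `g a ⟶ b f` is an isomorphism. -/
def Invertible (φ : Cell f g a b) : Prop := IsIso φ.hom

lemma Invertible.isIso {φ : Cell f g a b} (hφ : φ.Invertible) : IsIso φ.hom := hφ

lemma Invertible.comp {φ : Cell f g a b} {ψ : Cell f' g' b c} (hφ : φ.Invertible)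
    (hψ : ψ.Invertible) : (φ.comp ψ).Invertible := by
  unfold Invertible at *
  unfold Cell.comp compAux
  infer_instance

lemma Invertible.copy {φ : Cell f g a b} (hφ : φ.Invertible) {h : x ⟶ x'} {k : y ⟶ y'}
    (hh : f = h) (hk : g = k) : (φ.copy hh hk).Invertible := by
  subst hh hk; exact hφ

/-- The invertible cell from `a` to `g a` with right boundary `g`. -/
def pushCell {x y y' : C} (a : Vec A x y) (g : y ⟶ y') :
    Cell (𝟙 x) g a ((act A (post x g)).obj a) :=
  ⟨(actId A (pre (𝟙 x) y') rfl).inv.app _⟩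

lemma pushCell_invertible {x y y' : C} (a : Vec A x y) (g : y ⟶ y') : (pushCell a g).Invertible := by
  unfold Invertible pushCell; infer_instance

/-- The factorization of a cell through an invertible cell with identity left boundary (see `tot_desc`). -/
noncomputable def desc {x x' y y' y'' : C} {g : y ⟶ y'} {a : Vec A x y} {b : Vec A x y'}
    (ψ : Cell (𝟙 x) g a b) (hψ : ψ.Invertible) {f : x ⟶ x'} {k : y ⟶ y''} {c : Vec A x' y''}
    (φ : Cell f k a c) (h : y' ⟶ y'') (hk : g ≫ h = k) : Cell f h b c :=
  haveI := hψ.isIso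
  ⟨push (inv ψ.hom) (post x h) (post x h) (post x k) (by simp) (by simp [hk]) ≫ φ.hom⟩

lemma tot_desc {x x' y y' y'' : C} {g : y ⟶ y'} {a : Vec A x y} {b : Vec A x y'}
    (ψ : Cell (𝟙 x) g a b) (hψ : ψ.Invertible) {f : x ⟶ x'} {k : y ⟶ y''} {c : Vec A x' y''}
    (φ : Cell f k a c) (h : y' ⟶ y'') (hk : g ≫ h = k) :
    ψ.tot ≫ (desc ψ hψ φ h hk).tot = φ.tot := by
  have := hψ.isIso
  rw [← tot_compAux _ _ f k (by simp) hk]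
  congr 1
  ext
  rw [id_left_compAux]
  unfold desc
  dsimp only
  rw [← Category.assoc, ← push_comp (hw := by simp [hk])]
  rw [IsIso.hom_inv_id, push_id_right, Category.id_comp]

lemma tot_epi {x x' y y' y'' : C} {g : y ⟶ y'} {a : Vec A x y} {b : Vec A x y'}
    (ψ : Cell (𝟙 x) g a b) (hψ : ψ.Invertible) {f f' : x ⟶ x'} {h h' : y' ⟶ y''} {c : Vec A x' y''}
    (φ : Cell f h b c) (φ' : Cell f' h' b c) (hh : h = h') (H : ψ.tot ≫ φ.tot = ψ.tot ≫ φ'.tot) :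
    φ.tot = φ'.tot := by
  have hf : f = f' := by
    have := congrArg Tot.Hom.left H
    exact (Category.id_comp f).symm.trans (this.trans (Category.id_comp f'))
  subst hf hh
  congr 1
  have := hψ.isIso
  rw [← tot_compAux _ _ f (g ≫ h) (by simp) rfl, ← tot_compAux _ _ f (g ≫ h) (by simp) rfl] at H
  have H' := congrArg Cell.hom (tot_inj H)
  rw [id_left_compAux, id_left_compAux] at H'
  ext
  exact (cancel_epi _).1 H'

end Cell
end Cells

section Star
variable {C : Type u} [Category.{v} C] (A : Mod.{v₁, u₁} C)

/-- The structural isomorphism `g (a f) ≅ (g a) f`. -/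
def swap {w x y z : C} (f : w ⟶ x) (g : y ⟶ z) :
    act A (pre f y) ⋙ act A (post w g) ≅ act A (post x g) ⋙ act A (pre f z) :=
  (actComp A (pre f y) (post w g) (f.op, g) (by simp)).symm ≪≫
    actComp A (post x g) (pre f z) (f.op, g) (by simp)

/-- A choice of right adjoints `copost w g` of the functors `a ↦ g a` (the left opaction `a ↦ g^* a`) and
of left adjoints `copre f y` of the functors `a ↦ a f` (the right opaction `a ↦ a f^*`). -/
structure Opactions where
  copost (w : C) {y z : C} (g : y ⟶ z) : Vec A w z ⥤ Vec A w y
  copostAdj (w : C) {y z : C} (g : y ⟶ z) : act A (post w g) ⊣ copost w g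
  copre {w x : C} (f : w ⟶ x) (y : C) : Vec A w y ⥤ Vec A x y
  copreAdj {w x : C} (f : w ⟶ x) (y : C) : copre f y ⊣ act A (pre f y)

namespace Opactions
variable {A} (S : Opactions A)

/-- The mate `(k a) f^* ⟶ k (a f^*)` of the structural isomorphism. -/
def preMate {w x y z : C} (f : w ⟶ x) (k : y ⟶ z) :
    act A (post w k) ⋙ S.copre f z ⟶ S.copre f y ⋙ act A (post x k) :=
  (mateEquiv (S.copreAdj f y) (S.copreAdj f z)).symm (swap A f k).hom

/-- The mate `(g^* a) l ⟶ g^* (a l)` of the structural isomorphism. -/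
def postMate {w x y z : C} (l : w ⟶ x) (g : y ⟶ z) :
    S.copost x g ⋙ act A (pre l y) ⟶ act A (pre l z) ⋙ S.copost w g :=
  mateEquiv (S.copostAdj x g) (S.copostAdj w g) (swap A l g).hom

end Opactions

/-- A `∗`-module: the mates of the structural isomorphisms are invertible, and the two transformations
`(g^* a) f^* ⟶ g^* (a f^*)` obtained as mates of their inverses agree and are invertible. -/
structure StarModule extends Opactions A where
  preMate_isIso {w x y z : C} (f : w ⟶ x) (k : y ⟶ z) : IsIso (toOpactions.preMate f k)
  postMate_isIso {w x y z : C} (l : w ⟶ x) (g : y ⟶ z) : IsIso (toOpactions.postMate l g)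
  mate_eq {w x y z : C} (f : w ⟶ x) (g : y ⟶ z) :
    (mateEquiv (copostAdj w g) (copostAdj x g)
        (inv (toOpactions.preMate f g)) : copost w g ⋙ copre f y ⟶ copre f z ⋙ copost x g) =
      (mateEquiv (copreAdj f z) (copreAdj f y)).symm (inv (toOpactions.postMate f g))
  mate_isIso {w x y z : C} (f : w ⟶ x) (g : y ⟶ z) :
    IsIso (X := copost w g ⋙ copre f y) (Y := copre f z ⋙ copost x g)
      (mateEquiv (copostAdj w g) (copostAdj x g) (inv (toOpactions.preMate f g)))

namespace StarModule
variable {A} (S : StarModule A)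

instance {w x y z : C} (f : w ⟶ x) (k : y ⟶ z) : IsIso (S.preMate f k) := S.preMate_isIso f k
instance {w x y z : C} (f : w ⟶ x) (k : y ⟶ z) : IsIso (S.postMate f k) := S.postMate_isIso f k

/-- The universal cell from `g^* a` to `a` with right boundary `g`, given by the counit of the
adjunction between `g` and `g^*`. -/
def starCell {x y z : C} (g : y ⟶ z) (a : Vec A x z) : Cell (𝟙 x) g ((S.copost x g).obj a) a :=
  ⟨(S.copostAdj x g).counit.app a ≫ (actId A (pre (𝟙 x) z) rfl).inv.app a⟩

variable {x x' y y' y'' : C} {f : x ⟶ x'} {g : y ⟶ y'} {h : y' ⟶ y''} {k : y ⟶ y''}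
  {d : Vec A x y} {b : Vec A x' y''}

/-- A cell `d ⟶ b` with right boundary `g ≫ h` has a mate: the cell `d ⟶ h^* b` with right
boundary `g` whose composite with the universal cell is the given one (see `tot_starLift`; it is unique
by `starCell_mono`). -/
noncomputable def starLift (φ : Cell f k d b) (g : y ⟶ y') (h : y' ⟶ y'') (hk : g ≫ h = k) :
    Cell f g d ((S.copost x' h).obj b) :=
  ⟨(S.copostAdj x h).homEquiv _ _
    ((actComp A (post x g) (post x h) (post x k) (by simp [hk])).inv.app d ≫ φ.hom) ≫
      (inv (S.postMate f h)).app b⟩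

lemma compAux_starCell (χ : Cell f g d ((S.copost x' h).obj b)) (hk : g ≫ h = k) :
    (χ.compAux (S.starCell h b) f k (by simp) hk).hom =
      (actComp A (post x g) (post x h) (post x k) (by simp [hk])).hom.app d ≫
        ((S.copostAdj x h).homEquiv _ _).symm (χ.hom ≫ (S.postMate f h).app b) := by
  have h1 := mateEquiv_counit (S.copostAdj x' h) (S.copostAdj x h) (swap A f h).hom b
  have h2 := actId_comp A (pre (𝟙 x') y'') rfl (pre f y'') (by simp) b
  have h3 : (act A (pre f y'')).map ((actId A (pre (𝟙 x') y'') rfl).inv.app b) ≫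
    (actComp A (pre (𝟙 x') y'') (pre f y'') (pre f y'') (by simp)).inv.app b = 𝟙 _ := by
    rw [← h2, Iso.hom_inv_id_app]
    rfl
  unfold Cell.compAux push starCell
  dsimp only
  rw [Adjunction.homEquiv_counit, Functor.map_comp, Functor.map_comp, Category.assoc,
    Category.assoc, Category.assoc, Category.assoc, h3]
  erw [h1]
  simp [swap]

lemma tot_starLift (φ : Cell f k d b) (hk : g ≫ h = k) :
    (S.starLift φ g h hk).tot ≫ (S.starCell h b).tot = φ.tot := by
  rw [← Cell.tot_compAux _ _ f k (by simp) hk]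
  congr 1
  ext
  rw [compAux_starCell]
  unfold starLift
  dsimp only
  have h1 (t : (act A (post x g)).obj d ⟶ (S.copost x h).obj ((act A (pre f y'')).obj b)) :
      (t ≫ (inv (S.postMate f h)).app b) ≫ (S.postMate f h).app b = t := by
    rw [Category.assoc, ← NatTrans.comp_app, IsIso.inv_hom_id]
    exact Category.comp_id t
  refine (congrArg (fun t => _ ≫ ((S.copostAdj x h).homEquiv _ _).symm t) (h1 _)).trans ?_
  rw [Equiv.symm_apply_apply, Iso.hom_inv_id_app_assoc]

lemma starCell_mono {f' : x ⟶ x'} {g' : y ⟶ y'} (χ : Cell f g d ((S.copost x' h).obj b))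
    (χ' : Cell f' g' d ((S.copost x' h).obj b)) (hg : g = g')
    (H : χ.tot ≫ (S.starCell h b).tot = χ'.tot ≫ (S.starCell h b).tot) : χ.tot = χ'.tot := by
  have hf : f = f' := by
    have := congrArg Tot.Hom.left H
    exact (Category.comp_id f).symm.trans (this.trans (Category.comp_id f'))
  subst hf hg
  congr 1
  rw [← Cell.tot_compAux _ _ f (g ≫ h) (by simp) rfl,
    ← Cell.tot_compAux _ _ f (g ≫ h) (by simp) rfl] at H
  have H' := congrArg Cell.hom (Cell.tot_inj H)
  rw [compAux_starCell, compAux_starCell] at H'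
  have H2 := (Equiv.injective _) ((cancel_epi _).1 H')
  ext
  exact (cancel_mono _).1 H2

/-- The mate `a f^* ⟶ g^* b` of a cell `g a ⟶ b f`. It is invertible for the cells that exhibit the
opactions. -/
noncomputable def coMate {x x' y y' : C} {f : x ⟶ x'} {g : y ⟶ y'} {a : Vec A x y} {b : Vec A x' y'}
    (φ : Cell f g a b) : (S.copre f y).obj a ⟶ (S.copost x' g).obj b :=
  ((S.copreAdj f y).homEquiv _ _).symm ((S.copostAdj x g).homEquiv _ _ φ.hom ≫
    (inv (S.postMate f g)).app b)

end StarModule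
end Star

/-- Composable chains of "vectors" `x = x₀ → x₁ → ⋯ → xₙ = y`, of any length `n ≥ 0`. -/
inductive Chain {C : Type u} (V : C → C → Type w) : C → C → Type max u w
  | nil (x : C) : Chain V x x
  | cons {x y z : C} (a : V x y) (p : Chain V y z) : Chain V x z

namespace Chain
variable {C : Type u} {V : C → C → Type w} {W : C → C → Type t}

/-- A chain of length one. -/
abbrev single {x y : C} (a : V x y) : Chain V x y := cons a (nil y)

/-- Concatenation of chains. -/
def append : ∀ {x y z : C}, Chain V x y → Chain V y z → Chain V x z
  | _, _, _, nil _, q => q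
  | _, _, _, cons a p, q => cons a (append p q)

/-- Concatenation of a chain of chains. A chain of chains is a chain together with a partition
`n = n₁ + ⋯ + n_k` of its length (where `n_i = 0` is allowed). -/
def flatten : ∀ {x y : C}, Chain (Chain V) x y → Chain V x y
  | _, _, nil x => nil x
  | _, _, cons p pp => append p (flatten pp)

/-- Apply a map to all members of a chain. -/
def map (φ : ∀ {x y : C}, V x y → W x y) : ∀ {x y : C}, Chain V x y → Chain W x y
  | _, _, nil x => nil x
  | _, _, cons a p => cons (φ a) (map φ p)

/-- Apply a map over a function on objects to all members of a chain. -/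
def mapOver {D : Type*} {W : D → D → Type t} (o : C → D)
    (φ : ∀ {x y : C}, V x y → W (o x) (o y)) :
    ∀ {x y : C}, Chain V x y → Chain W (o x) (o y)
  | _, _, nil x => nil (o x)
  | _, _, cons a p => cons (φ a) (mapOver o φ p)

/-- The chain has length at least one. -/
def Nonempty : ∀ {x y : C}, Chain V x y → Prop
  | _, _, nil _ => False
  | _, _, cons _ _ => True

lemma append_nil : ∀ {x y : C} (p : Chain V x y), append p (nil y) = p
  | _, _, nil _ => rfl
  | _, _, cons a p => congrArg (cons a) (append_nil p)

lemma append_assoc : ∀ {x y z w : C} (p : Chain V x y) (q : Chain V y z) (r : Chain V z w),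
    append (append p q) r = append p (append q r)
  | _, _, _, _, nil _, _, _ => rfl
  | _, _, _, _, cons a p, q, r => congrArg (cons a) (append_assoc p q r)

lemma flatten_append : ∀ {x y z : C} (p : Chain (Chain V) x y) (q : Chain (Chain V) y z),
    flatten (append p q) = append (flatten p) (flatten q)
  | _, _, _, nil _, _ => rfl
  | _, _, _, cons a p, q =>
    (congrArg (append a) (flatten_append p q)).trans (append_assoc _ _ _).symm

lemma flatten_flatten : ∀ {x y : C} (ppp : Chain (Chain (Chain V)) x y),
    flatten (flatten ppp) = flatten (map flatten ppp)
  | _, _, nil _ => rfl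
  | _, _, cons p ppp =>
    (flatten_append p _).trans (congrArg (append (flatten p)) (flatten_flatten ppp))

lemma map_append (φ : ∀ {x y : C}, V x y → W x y) :
    ∀ {x y z : C} (p : Chain V x y) (q : Chain V y z),
      map φ (append p q) = append (map φ p) (map φ q)
  | _, _, _, nil _, _ => rfl
  | _, _, _, cons a p, q => congrArg (cons (φ a)) (map_append φ p q)

lemma map_flatten (φ : ∀ {x y : C}, V x y → W x y) :
    ∀ {x y : C} (pp : Chain (Chain V) x y), map φ (flatten pp) = flatten (map (map φ) pp)
  | _, _, nil _ => rfl
  | _, _, cons p pp =>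
    (map_append φ p _).trans (congrArg (append (map φ p)) (map_flatten φ pp))

lemma flatten_singles : ∀ {x y : C} (p : Chain V x y), flatten (map single p) = p
  | _, _, nil _ => rfl
  | _, _, cons a p => congrArg (cons a) (flatten_singles p)

lemma map_map_id (φ : ∀ {x y : C}, V x y → W x y) (ψ : ∀ {x y : C}, W x y → V x y)
    (h : ∀ {x y : C} (a : V x y), ψ (φ a) = a) :
    ∀ {x y : C} (p : Chain V x y), map ψ (map φ p) = p
  | _, _, nil _ => rfl
  | _, _, cons a p => congrArg₂ cons (h a) (map_map_id φ ψ h p)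

section
variable {D : Type*} {W : D → D → Type t} (o : C → D) (φ : ∀ {x y : C}, V x y → W (o x) (o y))

lemma mapOver_append : ∀ {x y z : C} (p : Chain V x y) (q : Chain V y z),
      mapOver o φ (append p q) = append (mapOver o φ p) (mapOver o φ q)
  | _, _, _, nil _, _ => rfl
  | _, _, _, cons a p, q => congrArg (cons (φ a)) (mapOver_append p q)

lemma mapOver_flatten : ∀ {x y : C} (pp : Chain (Chain V) x y),
    mapOver o φ (flatten pp) = flatten (mapOver o (mapOver o φ) pp)
  | _, _, nil _ => rfl
  | _, _, cons p pp =>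
    (mapOver_append o φ p _).trans (congrArg (append (mapOver o φ p)) (mapOver_flatten pp))
end
end Chain

section ChainHom
variable {C : Type u} [Category.{v} C] {V : C → C → Type w}

/-- Horizontally composable chains of squares. The chains of length zero are the scalars. -/
inductive ChainHom (H : ∀ ⦃x x' y y' : C⦄, (x ⟶ x') → (y ⟶ y') → V x y → V x' y' → Type t) :
    ∀ ⦃x x' y y' : C⦄, (x ⟶ x') → (y ⟶ y') → Chain V x y → Chain V x' y' → Type max u v w t
  | nil {x x' : C} (f : x ⟶ x') : ChainHom H f f (.nil x) (.nil x')
  | cons {x x' y y' z z' : C} {f : x ⟶ x'} {g : y ⟶ y'} {h : z ⟶ z'} {a : V x y} {b : V x' y'}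
      {p : Chain V y z} {q : Chain V y' z'} (φ : H f g a b) (Φ : ChainHom H g h p q) :
      ChainHom H f h (.cons a p) (.cons b q)

namespace ChainHom
variable {H : ∀ ⦃x x' y y' : C⦄, (x ⟶ x') → (y ⟶ y') → V x y → V x' y' → Type t}

/-- The chain of identity squares. -/
def id (i : ∀ {x y : C} (a : V x y), H (𝟙 x) (𝟙 y) a a) :
    ∀ {x y : C} (p : Chain V x y), ChainHom H (𝟙 x) (𝟙 y) p p
  | _, _, .nil x => .nil (𝟙 x)
  | _, _, .cons a p => .cons (i a) (id i p)

/-- Vertical composition of chains of squares. -/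
def comp (c : ∀ {x x' x'' y y' y'' : C} {f : x ⟶ x'} {g : y ⟶ y'} {f' : x' ⟶ x''} {g' : y' ⟶ y''}
      {a : V x y} {b : V x' y'} {d : V x'' y''},
      H f g a b → H f' g' b d → H (f ≫ f') (g ≫ g') a d) :
    ∀ {x x' x'' y y' y'' : C} {f : x ⟶ x'} {g : y ⟶ y'} {f' : x' ⟶ x''} {g' : y' ⟶ y''}
      {p : Chain V x y} {q : Chain V x' y'} {r : Chain V x'' y''},
      ChainHom H f g p q → ChainHom H f' g' q r → ChainHom H (f ≫ f') (g ≫ g') p r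
  | _, _, _, _, _, _, _, _, _, _, _, _, _, .nil f, .nil g => .nil (f ≫ g)
  | _, _, _, _, _, _, _, _, _, _, _, _, _, .cons φ Φ, .cons ψ Ψ => .cons (c φ ψ) (comp c Φ Ψ)

/-- Concatenation of chains of squares. -/
def append : ∀ {x x' y y' z z' : C} {f : x ⟶ x'} {g : y ⟶ y'} {h : z ⟶ z'}
      {p : Chain V x y} {p' : Chain V x' y'} {q : Chain V y z} {q' : Chain V y' z'},
      ChainHom H f g p p' → ChainHom H g h q q' → ChainHom H f h (p.append q) (p'.append q')
  | _, _, _, _, _, _, _, _, _, _, _, _, _, .nil _, Ψ => Ψ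
  | _, _, _, _, _, _, _, _, _, _, _, _, _, .cons φ Φ, Ψ => .cons φ (append Φ Ψ)

/-- Concatenation of a chain of chains of squares. -/
def flatten : ∀ {x x' y y' : C} {f : x ⟶ x'} {g : y ⟶ y'}
      {p : Chain (Chain V) x y} {q : Chain (Chain V) x' y'},
      ChainHom (ChainHom H) f g p q → ChainHom H f g p.flatten q.flatten
  | _, _, _, _, _, _, _, _, .nil f => .nil f
  | _, _, _, _, _, _, _, _, .cons Φ ΦΦ => append Φ (flatten ΦΦ)

/-- Apply a map to all members of a chain of squares. -/
def map {W : C → C → Type*}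
    {K : ∀ ⦃x x' y y' : C⦄, (x ⟶ x') → (y ⟶ y') → W x y → W x' y' → Type*}
    (P : ∀ {x y : C}, V x y → W x y)
    (Q : ∀ {x x' y y' : C} {f : x ⟶ x'} {g : y ⟶ y'} {a : V x y} {b : V x' y'},
      H f g a b → K f g (P a) (P b)) :
    ∀ {x x' y y' : C} {f : x ⟶ x'} {g : y ⟶ y'} {p : Chain V x y} {q : Chain V x' y'},
      ChainHom H f g p q → ChainHom K f g (p.map P) (q.map P)
  | _, _, _, _, _, _, _, _, .nil f => .nil f
  | _, _, _, _, _, _, _, _, .cons φ Φ => .cons (Q φ) (map P Q Φ)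

/-- All members of the chain satisfy a property. -/
def All (Q : ∀ {x x' y y' : C} {f : x ⟶ x'} {g : y ⟶ y'} {a : V x y} {b : V x' y'},
      H f g a b → Prop) :
    ∀ {x x' y y' : C} {f : x ⟶ x'} {g : y ⟶ y'} {p : Chain V x y} {q : Chain V x' y'},
      ChainHom H f g p q → Prop
  | _, _, _, _, _, _, _, _, .nil _ => True
  | _, _, _, _, _, _, _, _, .cons φ Φ => Q φ ∧ All Q Φ

end ChainHom
end ChainHom

variable {C : Type u} [Category.{v} C]

/-- Composable chains of vectors of a module. -/
abbrev VChain (A : Mod.{v₁, u₁} C) : C → C → Type max u u₁ := Chain (Vec A)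
/-- Horizontally composable chains of cells of a module. -/
abbrev CellChain (A : Mod.{v₁, u₁} C) : ∀ ⦃x x' y y' : C⦄, (x ⟶ x') → (y ⟶ y') →
    VChain A x y → VChain A x' y' → Type max u v u₁ v₁ :=
  ChainHom (fun _ _ _ _ f g a b => Cell f g a b)

/-- Data for multifold compositions: identity vectors, composites of chains of length at least two,
and their action on cells. The composite of a chain of length one is its member, see `P`. -/
structure CompData (A : Mod.{v₁, u₁} C) where
  unit (x : C) : Vec A x x
  comp {x y z w : C} (a : Vec A x y) (b : Vec A y z) (p : VChain A z w) : Vec A x w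
  unitCell {x x' : C} (f : x ⟶ x') : Cell f f (unit x) (unit x')
  compCell {x x' y y' z z' w w' : C} {f : x ⟶ x'} {g : y ⟶ y'} {h : z ⟶ z'} {k : w ⟶ w'}
    {a : Vec A x y} {a' : Vec A x' y'} {b : Vec A y z} {b' : Vec A y' z'}
    {p : VChain A z w} {p' : VChain A z' w'} (φ : Cell f g a a') (ψ : Cell g h b b')
    (Φ : CellChain A h k p p') : Cell f k (comp a b p) (comp a' b' p')

namespace CompData
variable {A : Mod.{v₁, u₁} C} (D : CompData A)

/-- The multifold composition of vectors, where the 1-fold composition is the identity functor. -/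
def P : ∀ {x y : C}, VChain A x y → Vec A x y
  | _, _, .nil x => D.unit x
  | _, _, .cons a (.nil _) => a
  | _, _, .cons a (.cons b p) => D.comp a b p

/-- The multifold composition of horizontally composable cells. -/
def PCell : ∀ {x x' y y' : C} {f : x ⟶ x'} {g : y ⟶ y'} {p : VChain A x y} {q : VChain A x' y'},
    CellChain A f g p q → Cell f g (D.P p) (D.P q)
  | _, _, _, _, _, _, _, _, .nil f => D.unitCell f
  | _, _, _, _, _, _, _, _, .cons φ (.nil _) => φ
  | _, _, _, _, _, _, _, _, .cons φ (.cons ψ Φ) => D.compCell φ ψ Φ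

/-- The chain of the components of `ξ` at the members of a chain of chains of chains. -/
def assocChain
    (ξ : ∀ {x y : C} (pp : Chain (VChain A) x y), D.P pp.flatten ⟶ D.P (pp.map D.P)) :
    ∀ {x y : C} (ppp : Chain (Chain (VChain A)) x y),
      CellChain A (𝟙 x) (𝟙 y) ((ppp.map Chain.flatten).map D.P) ((ppp.map (Chain.map D.P)).map D.P)
  | _, _, .nil x => .nil (𝟙 x)
  | _, _, .cons pp ppp => .cons (Cell.ofHom (ξ pp)) (assocChain ξ ppp)

lemma P_map_flatten {x y : C} (ppp : Chain (Chain (VChain A)) x y) :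
    D.P (ppp.flatten.map D.P) = D.P (ppp.map (Chain.map D.P)).flatten :=
  congrArg D.P (Chain.map_flatten _ ppp)

lemma P_flatten_flatten {x y : C} (ppp : Chain (Chain (VChain A)) x y) :
    D.P ppp.flatten.flatten = D.P (ppp.map Chain.flatten).flatten :=
  congrArg D.P (Chain.flatten_flatten ppp)

lemma P_singles {x y : C} (p : VChain A x y) :
    D.P (p.map Chain.single).flatten = D.P ((p.map Chain.single).map D.P) :=
  congrArg D.P ((Chain.flatten_singles p).trans
    (Chain.map_map_id Chain.single D.P (fun _ => rfl) p).symm)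

end CompData

/-- A 2-cell of a module, as a morphism of `Tot A`. -/
def gl {A : Mod.{v₁, u₁} C} {x y : C} {a b : Vec A x y} (α : a ⟶ b) : Tot.mk a ⟶ Tot.mk b :=
  (Cell.ofHom α).tot

/-- An equipment with category of scalars `C`: a module, multifold compositions `P`, and a lax
associator `ξ`.

The composition functors `P_{x₀, …, xₙ}`, pseudonatural in the outer and pseudo-dinatural in the inner
objects, are encoded through their action on chains of cells: a cell with scalar boundaries `f`, `g`
is a 2-cell `g a ⟶ b f`, and a family of functors that is pseudo(di)natural in the scalars acts on
horizontally composable chains of cells, functorially for vertical composition and preserving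
invertible cells. Conversely, the structural isomorphisms `g P(…) ≅ P(…, g -)`, `P(a g, b) ≅ P(a, g b)`
and so on are the images of the invertible cells that exhibit the scalar actions, and the functors
themselves are the actions on cells with identity scalar boundaries.

The component of `ξ` at a chain of chains is a 2-cell from the composite of the flattened chain to the
composite of the composites. It is natural with respect to all cells (i.e. it is natural, and a
modification), it is the identity for the partitions `n = n` and `n = 1 + ⋯ + 1`, and it is
associative. -/
structure Equipment (C : Type u) [Category.{v} C] where
  mod : Mod.{v₁, u₁} C
  toComp : CompData mod
  PCell_id {x y : C} (p : VChain mod x y) :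
    (toComp.PCell (ChainHom.id (fun a => Cell.id a) p)).tot = 𝟙 _
  PCell_comp {x x' x'' y y' y'' : C} {f : x ⟶ x'} {g : y ⟶ y'} {f' : x' ⟶ x''} {g' : y' ⟶ y''}
      {p : VChain mod x y} {q : VChain mod x' y'} {r : VChain mod x'' y''}
      (Φ : CellChain mod f g p q) (Ψ : CellChain mod f' g' q r) :
    (toComp.PCell (ChainHom.comp (fun φ ψ => φ.comp ψ) Φ Ψ)).tot =
      (toComp.PCell Φ).tot ≫ (toComp.PCell Ψ).tot
  PCell_invertible {x x' y y' : C} {f : x ⟶ x'} {g : y ⟶ y'} {p : VChain mod x y}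
      {q : VChain mod x' y'} (Φ : CellChain mod f g p q) (hΦ : Φ.All (fun φ => φ.Invertible)) :
    (toComp.PCell Φ).Invertible
  ξ {x y : C} (pp : Chain (VChain mod) x y) : toComp.P pp.flatten ⟶ toComp.P (pp.map toComp.P)
  ξ_natural {x x' y y' : C} {f : x ⟶ x'} {g : y ⟶ y'} {pp : Chain (VChain mod) x y}
      {qq : Chain (VChain mod) x' y'} (ΦΦ : ChainHom (CellChain mod) f g pp qq) :
    (toComp.PCell ΦΦ.flatten).tot ≫ gl (ξ qq) =
      gl (ξ pp) ≫ (toComp.PCell (ΦΦ.map toComp.P toComp.PCell)).tot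
  ξ_single {x y : C} (p : VChain mod x y) :
    ξ (.single p) = eqToHom (congrArg toComp.P p.append_nil)
  ξ_singles {x y : C} (p : VChain mod x y) :
    ξ (p.map .single) = eqToHom (toComp.P_singles p)
  ξ_assoc {x y : C} (ppp : Chain (Chain (VChain mod)) x y) :
    gl (ξ ppp.flatten) ≫ gl (eqToHom (toComp.P_map_flatten ppp)) ≫
        gl (ξ (ppp.map (Chain.map toComp.P))) =
      gl (eqToHom (toComp.P_flatten_flatten ppp)) ≫ gl (ξ (ppp.map Chain.flatten)) ≫
        (toComp.PCell (toComp.assocChain ξ ppp)).tot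

section EqF
universe v' u' v₂ u₂

/-- A family of functors `Vec A x y ⥤ Vec B (F x) (F y)` pseudonatural in both arguments, encoded as
a functorial action on cells that preserves invertible cells. -/
structure FunctorData {C : Type u} [Category.{v} C] {D : Type u'} [Category.{v'} D]
    (A : Mod.{v₁, u₁} C) (B : Mod.{v₂, u₂} D) (F : C ⥤ D) where
  obj {x y : C} (a : Vec A x y) : Vec B (F.obj x) (F.obj y)
  cell {x x' y y' : C} {f : x ⟶ x'} {g : y ⟶ y'} {a : Vec A x y} {b : Vec A x' y'}
    (φ : Cell f g a b) : Cell (F.map f) (F.map g) (obj a) (obj b)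
  cell_id {x y : C} (a : Vec A x y) : (cell (Cell.id a)).tot = 𝟙 _
  cell_comp {x x' x'' y y' y'' : C} {f : x ⟶ x'} {g : y ⟶ y'} {f' : x' ⟶ x''} {g' : y' ⟶ y''}
    {a : Vec A x y} {b : Vec A x' y'} {c : Vec A x'' y''} (φ : Cell f g a b)
    (ψ : Cell f' g' b c) : (cell (φ.comp ψ)).tot = (cell φ).tot ≫ (cell ψ).tot
  cell_invertible {x x' y y' : C} {f : x ⟶ x'} {g : y ⟶ y'} {a : Vec A x y} {b : Vec A x' y'}
    (φ : Cell f g a b) (hφ : φ.Invertible) : (cell φ).Invertible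

namespace FunctorData
variable {C : Type u} [Category.{v} C] {D : Type u'} [Category.{v'} D]
    {A : Mod.{v₁, u₁} C} {B : Mod.{v₂, u₂} D} {F : C ⥤ D} (G : FunctorData A B F)

/-- The image of a chain of vectors. -/
def chain {x y : C} (p : VChain A x y) : VChain B (F.obj x) (F.obj y) :=
  p.mapOver F.obj G.obj

/-- The image of a chain of cells. -/
def cellChain : ∀ {x x' y y' : C} {f : x ⟶ x'} {g : y ⟶ y'} {p : VChain A x y}
      {q : VChain A x' y'}, CellChain A f g p q →
      CellChain B (F.map f) (F.map g) (G.chain p) (G.chain q)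
  | _, _, _, _, _, _, _, _, .nil f => .nil (F.map f)
  | _, _, _, _, _, _, _, _, .cons φ Φ => .cons (G.cell φ) (cellChain Φ)

/-- The induced functor on all cells. -/
def tot : Tot A ⥤ Tot B where
  obj X := ⟨G.obj X.vec⟩
  map φ := (G.cell φ.cell).tot
  map_id X := G.cell_id X.vec
  map_comp φ ψ := G.cell_comp φ.cell ψ.cell

/-- The action on 2-cells. -/
def hom {x y : C} {a b : Vec A x y} (α : a ⟶ b) : G.obj a ⟶ G.obj b :=
  ((G.cell (Cell.ofHom α)).copy (F.map_id x) (F.map_id y)).toHom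

/-- The chain of the comparison cells at the members of a chain of chains. -/
def comparisonChain (DA : CompData A) (DB : CompData B)
    (κ : ∀ {x y : C} (p : VChain A x y), DB.P (G.chain p) ⟶ G.obj (DA.P p)) :
    ∀ {x y : C} (pp : Chain (VChain A) x y),
      CellChain B (𝟙 (F.obj x)) (𝟙 (F.obj y))
        ((pp.mapOver F.obj G.chain).map DB.P) (G.chain (pp.map DA.P))
  | _, _, .nil x => .nil (𝟙 (F.obj x))
  | _, _, .cons p pp => .cons (Cell.ofHom (κ p)) (comparisonChain DA DB κ pp)

/-- The chain of cells `ν a : T T a ⟶ T a`. -/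
def mulChain {T₀ : C ⥤ C} (T : FunctorData A A T₀) (m : ∀ x : C, T₀.obj (T₀.obj x) ⟶ T₀.obj x)
    (ν : ∀ {x y : C} (a : Vec A x y), Cell (m x) (m y) (T.obj (T.obj a)) (T.obj a)) :
    ∀ {x y : C} (p : VChain A x y), CellChain A (m x) (m y) (T.chain (T.chain p)) (T.chain p)
  | _, _, .nil x => .nil (m x)
  | _, _, .cons a p => .cons (ν a) (mulChain T m ν p)

/-- The chain of cells `ν a : a ⟶ T a`. -/
def unitChain {T₀ : C ⥤ C} (T : FunctorData A A T₀) (e : ∀ x : C, x ⟶ T₀.obj x)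
    (ν : ∀ {x y : C} (a : Vec A x y), Cell (e x) (e y) a (T.obj a)) :
    ∀ {x y : C} (p : VChain A x y), CellChain A (e x) (e y) p (T.chain p)
  | _, _, .nil x => .nil (e x)
  | _, _, .cons a p => .cons (ν a) (unitChain T e ν p)

lemma chain_flatten {x y : C} (pp : Chain (VChain A) x y) :
    G.chain pp.flatten = (pp.mapOver F.obj G.chain).flatten :=
  Chain.mapOver_flatten _ _ pp

end FunctorData

/-- A (lax) functor between equipments over the functor of scalars `F`, with lax comparison structure
`κ` from the composite of the images to the image of the composite. The comparison is natural with
respect to all cells, it is the identity on chains of length one, and it is compatible with the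
associators. -/
structure EqFunctor {C : Type u} [Category.{v} C] {D : Type u'} [Category.{v'} D]
    (A : Equipment.{v₁, u₁} C) (B : Equipment.{v₂, u₂} D) (F : C ⥤ D) extends
    FunctorData A.mod B.mod F where
  κ {x y : C} (p : VChain A.mod x y) : B.toComp.P (toFunctorData.chain p) ⟶ obj (A.toComp.P p)
  κ_natural {x x' y y' : C} {f : x ⟶ x'} {g : y ⟶ y'} {p : VChain A.mod x y}
    {q : VChain A.mod x' y'} (Φ : CellChain A.mod f g p q) :
    (B.toComp.PCell (toFunctorData.cellChain Φ)).tot ≫ gl (κ q) =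
      gl (κ p) ≫ (cell (A.toComp.PCell Φ)).tot
  κ_single {x y : C} (a : Vec A.mod x y) : κ (.single a) = 𝟙 (obj a)
  κ_ξ {x y : C} (pp : Chain (VChain A.mod) x y) :
    gl (κ pp.flatten) ≫ (cell (Cell.ofHom (A.ξ pp))).tot =
      gl (eqToHom (congrArg B.toComp.P (toFunctorData.chain_flatten pp))) ≫
        gl (B.ξ (pp.mapOver F.obj toFunctorData.chain)) ≫
        (B.toComp.PCell (toFunctorData.comparisonChain A.toComp B.toComp κ pp)).tot ≫
        gl (κ (pp.map A.toComp.P))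

end EqF

/-- A `T`-equipment: an equipment, a monad `T₀` on its category of scalars, and a lift of this monad to a
monad on the equipment. The lift consists of a functor of equipments `T` over `T₀`, and transformations
`(m, νm) : T T ⟶ T` and `(e, νe) : 1 ⟶ T` of functors of equipments (natural with respect to all cells
and compatible with the comparison structures), subject to the monad laws. -/
structure TEquipment (C : Type u) [Category.{v} C] extends Equipment.{v₁, u₁} C where
  T₀ : Monad C
  T : EqFunctor toEquipment toEquipment (T₀ : C ⥤ C)
  νm {x y : C} (a : Vec mod x y) : Cell (T₀.μ.app x) (T₀.μ.app y) (T.obj (T.obj a)) (T.obj a)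
  νe {x y : C} (a : Vec mod x y) : Cell (T₀.η.app x) (T₀.η.app y) a (T.obj a)
  νm_natural {x x' y y' : C} {f : x ⟶ x'} {g : y ⟶ y'} {a : Vec mod x y} {b : Vec mod x' y'}
    (φ : Cell f g a b) :
    (T.cell (T.cell φ)).tot ≫ (νm b).tot = (νm a).tot ≫ (T.cell φ).tot
  νe_natural {x x' y y' : C} {f : x ⟶ x'} {g : y ⟶ y'} {a : Vec mod x y} {b : Vec mod x' y'}
    (φ : Cell f g a b) : φ.tot ≫ (νe b).tot = (νe a).tot ≫ (T.cell φ).tot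
  νm_κ {x y : C} (p : VChain mod x y) :
    (toComp.PCell (FunctorData.mulChain T.toFunctorData T₀.μ.app νm p)).tot ≫ gl (T.κ p) =
      gl (T.κ (T.chain p)) ≫ (T.cell (Cell.ofHom (T.κ p))).tot ≫ (νm (toComp.P p)).tot
  νe_κ {x y : C} (p : VChain mod x y) :
    (toComp.PCell (FunctorData.unitChain T.toFunctorData T₀.η.app νe p)).tot ≫ gl (T.κ p) =
      (νe (toComp.P p)).tot
  assoc {x y : C} (a : Vec mod x y) :
    (T.cell (νm a)).tot ≫ (νm a).tot = (νm (T.obj a)).tot ≫ (νm a).tot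
  left_unit {x y : C} (a : Vec mod x y) : (νe (T.obj a)).tot ≫ (νm a).tot = 𝟙 _
  right_unit {x y : C} (a : Vec mod x y) : (T.cell (νe a)).tot ≫ (νm a).tot = 𝟙 _

/-- A `T`-`∗`-equipment: a `T`-equipment whose module is a `∗`-module, such that the multifold
compositions (of chains of length at least one) and the functor `T` are compatible with the opactions.

Compatibility (pseudonaturality in the outer, pseudo-dinaturality in the inner arguments, with respect to
the opactions) is expressed as for the actions, by preservation of the cells that exhibit opactions up to
isomorphism, i.e. of the cells whose mate `a f^* ⟶ g^* b` is invertible. -/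
structure TStarEquipment (C : Type u) [Category.{v} C] extends TEquipment.{v₁, u₁} C where
  star : StarModule mod
  P_star {x x' y y' : C} {f : x ⟶ x'} {g : y ⟶ y'} {p : VChain mod x y}
    {q : VChain mod x' y'} (Φ : CellChain mod f g p q) (hp : p.Nonempty)
    (hΦ : Φ.All (fun φ => IsIso (star.coMate φ))) : IsIso (star.coMate (toComp.PCell Φ))
  T_star {x x' y y' : C} {f : x ⟶ x'} {g : y ⟶ y'} {a : Vec mod x y} {b : Vec mod x' y'}
    (φ : Cell f g a b) (hφ : IsIso (star.coMate φ)) : IsIso (star.coMate (T.cell φ))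

section Eqn
variable {A : Mod.{v₁, u₁} C}

lemma Cell.comp_eq {x x' x'' y y' y'' : C} {f : x ⟶ x'} {g : y ⟶ y'} {f' : x' ⟶ x''} {g' : y' ⟶ y''}
    {h : x ⟶ x''} {k : y ⟶ y''}
    {a : Vec A x y} {b : Vec A x' y'} {c : Vec A x'' y''} {φ : Cell f g a b}
    {ψ : Cell f' g' b c} {χ : Cell h k a c} (H : φ.tot ≫ ψ.tot = χ.tot) :
    f ≫ f' = h ∧ g ≫ g' = k :=
  ⟨congrArg Tot.Hom.left H, congrArg Tot.Hom.right H⟩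

lemma gl_comp {x y : C} {a b c : Vec A x y} (α : a ⟶ b) (β : b ⟶ c) :
    gl (α ≫ β) = gl α ≫ gl β := Cell.tot_ofHom_comp α β

lemma gl_id {x y : C} (a : Vec A x y) : gl (𝟙 a) = 𝟙 _ := Cell.tot_ofHom_id a

lemma gl_inj {x y : C} {a b : Vec A x y} {α β : a ⟶ b} (h : gl α = gl β) : α = β := by
  have h1 := congrArg Cell.hom (Cell.tot_inj h)
  have h2 := actId_naturality A (post x (𝟙 y)) rfl α
  have h3 := actId_naturality A (post x (𝟙 y)) rfl β
  have h4 : (act A (post x (𝟙 y))).map α = (act A (post x (𝟙 y))).map β := h1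
  rw [h4, h3] at h2
  exact ((cancel_epi _).1 h2).symm

lemma gl_toHom {x y : C} {a b : Vec A x y} (φ : Cell (𝟙 x) (𝟙 y) a b) : gl φ.toHom = φ.tot :=
  congrArg Cell.tot (Cell.ofHom_toHom φ)

@[simp] lemma tot_ofHom {x y : C} {a b : Vec A x y} (α : a ⟶ b) :
    (Cell.ofHom α).tot = gl α := rfl

end Eqn

namespace Equipment
variable (E : Equipment.{v₁, u₁} C)
variable {x x' x'' y y' y'' z z' z'' w w' : C}

/-- The binary composite of vectors. -/
abbrev P₂ (a : Vec E.mod x y) (b : Vec E.mod y z) : Vec E.mod x z :=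
  E.toComp.P (.cons a (.single b))

/-- The identity vector. -/
abbrev i (x : C) : Vec E.mod x x := E.toComp.unit x

variable {f : x ⟶ x'} {g : y ⟶ y'} {h : z ⟶ z'} {k : w ⟶ w'}
  {f' : x' ⟶ x''} {g' : y' ⟶ y''} {h' : z' ⟶ z''}
  {f'' : x ⟶ x''} {g'' : y ⟶ y''} {h'' : z ⟶ z''}

/-- The horizontal composite of two cells. -/
def c₂ {a : Vec E.mod x y} {a' : Vec E.mod x' y'} {b : Vec E.mod y z} {b' : Vec E.mod y' z'}
    (φ : Cell f g a a') (ψ : Cell g h b b') : Cell f h (E.P₂ a b) (E.P₂ a' b') :=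
  E.toComp.PCell (.cons φ (.cons ψ (.nil h)))

/-- The ternary composite of vectors. -/
abbrev P₃ (a : Vec E.mod x y) (b : Vec E.mod y z) (c : Vec E.mod z w) : Vec E.mod x w :=
  E.toComp.P (.cons a (.cons b (.single c)))

/-- The horizontal composite of three cells. -/
def c₃ {a : Vec E.mod x y} {a' : Vec E.mod x' y'} {b : Vec E.mod y z} {b' : Vec E.mod y' z'}
    {c : Vec E.mod z w} {c' : Vec E.mod z' w'}
    (φ : Cell f g a a') (ψ : Cell g h b b') (χ : Cell h k c c') :
      Cell f k (E.P₃ a b c) (E.P₃ a' b' c') :=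
  E.toComp.PCell (.cons φ (.cons ψ (.cons χ (.nil k))))

/-- The associator for the partition `3 = 2 + 1`. -/
def ξ₂₁ (a : Vec E.mod x y) (b : Vec E.mod y z) (c : Vec E.mod z w) :
    E.P₃ a b c ⟶ E.P₂ (E.P₂ a b) c :=
  E.ξ (.cons (.cons a (.single b)) (.single (.single c)))

/-- The associator for the partition `3 = 1 + 2`. -/
def ξ₁₂ (a : Vec E.mod x y) (b : Vec E.mod y z) (c : Vec E.mod z w) :
    E.P₃ a b c ⟶ E.P₂ a (E.P₂ b c) :=
  E.ξ (.cons (.single a) (.single (.cons b (.single c))))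

/-- The associator for the partition `1 = 0 + 1`. -/
def ξ₀₁ (a : Vec E.mod x y) : a ⟶ E.P₂ (E.i x) a :=
  E.ξ (.cons (.nil x) (.single (.single a)))

/-- The associator for the partition `1 = 1 + 0`. -/
def ξ₁₀ (a : Vec E.mod x y) : a ⟶ E.P₂ a (E.i y) :=
  E.ξ (.cons (.single a) (.single (.nil y)))

variable {a : Vec E.mod x y} {a' : Vec E.mod x' y'} {b : Vec E.mod y z} {b' : Vec E.mod y' z'}
    {c : Vec E.mod z w} {c' : Vec E.mod z' w'} {a'' : Vec E.mod x'' y''} {b'' : Vec E.mod y'' z''}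

lemma ξ₂₁_natural (φ : Cell f g a a') (ψ : Cell g h b b') (χ : Cell h k c c') :
    (E.c₃ φ ψ χ).tot ≫ gl (E.ξ₂₁ a' b' c') = gl (E.ξ₂₁ a b c) ≫ (E.c₂ (E.c₂ φ ψ) χ).tot :=
  E.ξ_natural (.cons (.cons φ (.cons ψ (.nil h))) (.cons (.cons χ (.nil k)) (.nil k)))

lemma ξ₁₂_natural (φ : Cell f g a a') (ψ : Cell g h b b') (χ : Cell h k c c') :
    (E.c₃ φ ψ χ).tot ≫ gl (E.ξ₁₂ a' b' c') = gl (E.ξ₁₂ a b c) ≫ (E.c₂ φ (E.c₂ ψ χ)).tot :=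
  E.ξ_natural (.cons (.cons φ (.nil g)) (.cons (.cons ψ (.cons χ (.nil k))) (.nil k)))

lemma ξ₀₁_natural (φ : Cell f g a a') :
    φ.tot ≫ gl (E.ξ₀₁ a') = gl (E.ξ₀₁ a) ≫ (E.c₂ (E.toComp.unitCell f) φ).tot :=
  E.ξ_natural (.cons (.nil f) (.cons (.cons φ (.nil g)) (.nil g)))

lemma ξ₁₀_natural (φ : Cell f g a a') :
    φ.tot ≫ gl (E.ξ₁₀ a') = gl (E.ξ₁₀ a) ≫ (E.c₂ φ (E.toComp.unitCell g)).tot :=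
  E.ξ_natural (.cons (.cons φ (.nil g)) (.cons (.nil g) (.nil g)))

lemma c₂_comp {φ : Cell f g a a'} {ψ : Cell g h b b'} {φ' : Cell f' g' a' a''}
    {ψ' : Cell g' h' b' b''} {φ'' : Cell f'' g'' a a''} {ψ'' : Cell g'' h'' b b''}
    (H : φ.tot ≫ φ'.tot = φ''.tot) (H' : ψ.tot ≫ ψ'.tot = ψ''.tot) :
    (E.c₂ φ ψ).tot ≫ (E.c₂ φ' ψ').tot = (E.c₂ φ'' ψ'').tot := by
  obtain ⟨rfl, rfl⟩ := Cell.comp_eq H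
  obtain ⟨-, rfl⟩ := Cell.comp_eq H'
  obtain rfl := Cell.tot_inj (φ := φ.comp φ') H
  obtain rfl := Cell.tot_inj (φ := ψ.comp ψ') H'
  exact (E.PCell_comp (.cons φ (.cons ψ (.nil h))) (.cons φ' (.cons ψ' (.nil h')))).symm

lemma c₂_congr {f₁ : x ⟶ x'} {g₁ : y ⟶ y'} {h₁ : z ⟶ z'} {φ : Cell f g a a'} {ψ : Cell g h b b'} {φ₁ : Cell f₁ g₁ a a'}
    {ψ₁ : Cell g₁ h₁ b b'}
    (H : φ.tot = φ₁.tot) (H' : ψ.tot = ψ₁.tot) : (E.c₂ φ ψ).tot = (E.c₂ φ₁ ψ₁).tot := by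
  obtain rfl : f = f₁ := congrArg Tot.Hom.left H
  obtain rfl : g = g₁ := congrArg Tot.Hom.right H
  obtain rfl : h = h₁ := congrArg Tot.Hom.right H'
  obtain rfl := Cell.tot_inj H
  obtain rfl := Cell.tot_inj H'
  rfl

lemma c₂_id (a : Vec E.mod x y) (b : Vec E.mod y z) :
    (E.c₂ (Cell.id a) (Cell.id b)).tot = 𝟙 _ :=
  E.PCell_id (.cons a (.single b))

lemma unitCell_id (x : C) : (E.toComp.unitCell (𝟙 x)).tot = 𝟙 _ := E.PCell_id (.nil x)

lemma unitCell_comp (f : x ⟶ x') (f' : x' ⟶ x'') :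
    (E.toComp.unitCell (f ≫ f')).tot = (E.toComp.unitCell f).tot ≫ (E.toComp.unitCell f').tot :=
  E.PCell_comp (.nil f) (.nil f')

lemma c₂_invertible {φ : Cell f g a a'} {ψ : Cell g h b b'} (hφ : φ.Invertible)
    (hψ : ψ.Invertible) : (E.c₂ φ ψ).Invertible :=
  E.PCell_invertible (.cons φ (.cons ψ (.nil h))) ⟨hφ, hψ, trivial⟩

lemma c₃_invertible {φ : Cell f g a a'} {ψ : Cell g h b b'} {χ : Cell h k c c'}
    (hφ : φ.Invertible) (hψ : ψ.Invertible) (hχ : χ.Invertible) : (E.c₃ φ ψ χ).Invertible :=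
  E.PCell_invertible (.cons φ (.cons ψ (.cons χ (.nil k)))) ⟨hφ, hψ, hχ, trivial⟩

end Equipment

namespace TEquipment
variable (E : TEquipment.{v₁, u₁} C)
variable {x x' y y' z z' w w' : C} {f : x ⟶ x'} {g : y ⟶ y'} {h : z ⟶ z'} {k : w ⟶ w'}

/-- The comparison cell for the empty chain. -/
def κ₀ (x : C) : E.i (E.T₀.obj x) ⟶ E.T.obj (E.i x) := E.T.κ (.nil x)

/-- The comparison cell for chains of length two. -/
def κ₂ (a : Vec E.mod x y) (b : Vec E.mod y z) :
    E.P₂ (E.T.obj a) (E.T.obj b) ⟶ E.T.obj (E.P₂ a b) := E.T.κ (.cons a (.single b))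

/-- The comparison cell for chains of length three. -/
def κ₃ (a : Vec E.mod x y) (b : Vec E.mod y z) (c : Vec E.mod z w) :
    E.P₃ (E.T.obj a) (E.T.obj b) (E.T.obj c) ⟶ E.T.obj (E.P₃ a b c) :=
  E.T.κ (.cons a (.cons b (.single c)))

/-- The action of `T` on all cells. -/
def τ {x x' y y' : C} {a : Vec E.mod x y} {a' : Vec E.mod x' y'} (φ : Tot.mk a ⟶ Tot.mk a') :
    Tot.mk (E.T.obj a) ⟶ Tot.mk (E.T.obj a') := (E.T.cell φ.cell).tot

variable {a : Vec E.mod x y} {a' : Vec E.mod x' y'} {b : Vec E.mod y z} {b' : Vec E.mod y' z'}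
    {c : Vec E.mod z w} {c' : Vec E.mod z' w'}

lemma τ_map (φ : Cell f g a a') : (E.T.cell φ).tot = E.τ φ.tot := rfl

lemma κ₂_natural (φ : Cell f g a a') (ψ : Cell g h b b') :
    (E.c₂ (E.T.cell φ) (E.T.cell ψ)).tot ≫ gl (E.κ₂ a' b') =
      gl (E.κ₂ a b) ≫ E.τ (E.c₂ φ ψ).tot :=
  E.T.κ_natural (.cons φ (.cons ψ (.nil h)))

lemma κ₀_natural (f : x ⟶ x') :
    (E.toComp.unitCell (E.T₀.map f)).tot ≫ gl (E.κ₀ x') =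
      gl (E.κ₀ x) ≫ E.τ (E.toComp.unitCell f).tot :=
  E.T.κ_natural (.nil f)

lemma τ_comp {x'' y'' : C} {a'' : Vec E.mod x'' y''} (φ : Tot.mk a ⟶ Tot.mk a')
    (ψ : Tot.mk a' ⟶ Tot.mk a'') : E.τ (φ ≫ ψ) = E.τ φ ≫ E.τ ψ := E.T.cell_comp φ.cell ψ.cell

lemma τ_id (a : Vec E.mod x y) : E.τ (𝟙 (Tot.mk a)) = 𝟙 _ := E.T.cell_id a

/-- The comparison cell for chains of length one (an identity). -/
def κ₁ (a : Vec E.mod x y) : E.T.obj a ⟶ E.T.obj a := E.T.κ (.single a)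

lemma κ₁_cell (a : Vec E.mod x y) : (Cell.ofHom (E.κ₁ a)).tot = (Cell.id (E.T.obj a)).tot := by
  rw [κ₁, E.T.κ_single]; exact gl_id _

lemma κ₂₁ (a : Vec E.mod x y) (b : Vec E.mod y z) (c : Vec E.mod z w) :
    gl (E.κ₃ a b c) ≫ E.τ (gl (E.ξ₂₁ a b c)) =
      gl (E.ξ₂₁ (E.T.obj a) (E.T.obj b) (E.T.obj c)) ≫
        (E.c₂ (Cell.ofHom (E.κ₂ a b)) (Cell.id (E.T.obj c))).tot ≫ gl (E.κ₂ (E.P₂ a b) c) := by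
  rw [← E.c₂_congr (φ := Cell.ofHom (E.κ₂ a b)) rfl (E.κ₁_cell c)]
  exact (E.T.κ_ξ (.cons (.cons a (.single b)) (.single (.single c)))).trans
    ((congrArg (· ≫ _) (gl_id _)).trans (Category.id_comp _))

lemma κ₁₂ (a : Vec E.mod x y) (b : Vec E.mod y z) (c : Vec E.mod z w) :
    gl (E.κ₃ a b c) ≫ E.τ (gl (E.ξ₁₂ a b c)) =
      gl (E.ξ₁₂ (E.T.obj a) (E.T.obj b) (E.T.obj c)) ≫
        (E.c₂ (Cell.id (E.T.obj a)) (Cell.ofHom (E.κ₂ b c))).tot ≫ gl (E.κ₂ a (E.P₂ b c)) := by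
  rw [← E.c₂_congr (ψ := Cell.ofHom (E.κ₂ b c)) (E.κ₁_cell a) rfl]
  exact (E.T.κ_ξ (.cons (.single a) (.single (.cons b (.single c))))).trans
    ((congrArg (· ≫ _) (gl_id _)).trans (Category.id_comp _))

lemma κ₀₁ (a : Vec E.mod x y) :
    E.τ (gl (E.ξ₀₁ a)) =
      gl (E.ξ₀₁ (E.T.obj a)) ≫
        (E.c₂ (Cell.ofHom (E.κ₀ x)) (Cell.id (E.T.obj a))).tot ≫ gl (E.κ₂ (E.i x) a) := by
  rw [← E.c₂_congr (φ := Cell.ofHom (E.κ₀ x)) rfl (E.κ₁_cell a)]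
  refine Eq.trans ?_ ((E.T.κ_ξ (.cons (.nil x) (.single (.single a)))).trans
    ((congrArg (· ≫ _) (gl_id _)).trans (Category.id_comp _)))
  exact (Category.id_comp _).symm.trans (congrArg (· ≫ _) (E.κ₁_cell a).symm)

lemma κ₁₀ (a : Vec E.mod x y) :
    E.τ (gl (E.ξ₁₀ a)) =
      gl (E.ξ₁₀ (E.T.obj a)) ≫
        (E.c₂ (Cell.id (E.T.obj a)) (Cell.ofHom (E.κ₀ y))).tot ≫ gl (E.κ₂ a (E.i y)) := by
  rw [← E.c₂_congr (ψ := Cell.ofHom (E.κ₀ y)) (E.κ₁_cell a) rfl]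
  refine Eq.trans ?_ ((E.T.κ_ξ (.cons (.single a) (.single (.nil y)))).trans
    ((congrArg (· ≫ _) (gl_id _)).trans (Category.id_comp _)))
  exact (Category.id_comp _).symm.trans (congrArg (· ≫ _) (E.κ₁_cell a).symm)

lemma νm_κ₂ (a : Vec E.mod x y) (b : Vec E.mod y z) :
    (E.c₂ (E.νm a) (E.νm b)).tot ≫ gl (E.κ₂ a b) =
      gl (E.κ₂ (E.T.obj a) (E.T.obj b)) ≫ E.τ (gl (E.κ₂ a b)) ≫ (E.νm (E.P₂ a b)).tot :=
  E.νm_κ (.cons a (.single b))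

lemma νm_κ₀ (x : C) :
    (E.toComp.unitCell (E.T₀.μ.app x)).tot ≫ gl (E.κ₀ x) =
      gl (E.κ₀ (E.T₀.obj x)) ≫ E.τ (gl (E.κ₀ x)) ≫ (E.νm (E.i x)).tot :=
  E.νm_κ (.nil x)

lemma νe_κ₂ (a : Vec E.mod x y) (b : Vec E.mod y z) :
    (E.c₂ (E.νe a) (E.νe b)).tot ≫ gl (E.κ₂ a b) = (E.νe (E.P₂ a b)).tot :=
  E.νe_κ (.cons a (.single b))

lemma νe_κ₀ (x : C) :
    (E.toComp.unitCell (E.T₀.η.app x)).tot ≫ gl (E.κ₀ x) = (E.νe (E.i x)).tot :=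
  E.νe_κ (.nil x)

lemma νm_nat (φ : Cell f g a a') :
    E.τ (E.τ φ.tot) ≫ (E.νm a').tot = (E.νm a).tot ≫ E.τ φ.tot := E.νm_natural φ

lemma νe_nat (φ : Cell f g a a') :
    φ.tot ≫ (E.νe a').tot = (E.νe a).tot ≫ E.τ φ.tot := E.νe_natural φ

lemma νm_assoc (a : Vec E.mod x y) :
    E.τ (E.νm a).tot ≫ (E.νm a).tot = (E.νm (E.T.obj a)).tot ≫ (E.νm a).tot := E.assoc a

lemma νe_νm (a : Vec E.mod x y) : (E.νe (E.T.obj a)).tot ≫ (E.νm a).tot = 𝟙 _ := E.left_unit a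

lemma T_νe_νm (a : Vec E.mod x y) : E.τ (E.νe a).tot ≫ (E.νm a).tot = 𝟙 _ := E.right_unit a

lemma gl_T_hom {a b : Vec E.mod x y} (α : a ⟶ b) : gl (E.T.hom α) = E.τ (gl α) :=
  (gl_toHom _).trans (Cell.tot_copy _ _ _)

section pasting
variable {x₁ y₁ z₁ w₁ : C} {f₁ : x ⟶ x₁} {g₁ : y ⟶ y₁} {h₁ : z ⟶ z₁} {k₁ : w ⟶ w₁}
variable {fT : E.T₀.obj x ⟶ E.T₀.obj x₁} {gT : E.T₀.obj y ⟶ E.T₀.obj y₁}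
  {hT : E.T₀.obj z ⟶ E.T₀.obj z₁} {kT : E.T₀.obj w ⟶ E.T₀.obj w₁}

lemma paste₂₁ {d : Vec E.mod x₁ z₁} {d' : Vec E.mod z₁ w₁}
    {φ : Cell f₁ h₁ (E.P₂ a b) d} {ψ : Cell h₁ k₁ c d'}
    {θ : Cell fT hT (E.P₂ (E.T.obj a) (E.T.obj b)) (E.T.obj d)}
    {χ : Cell hT kT (E.T.obj c) (E.T.obj d')}
    (hθ : θ.tot = gl (E.κ₂ a b) ≫ E.τ φ.tot) (hχ : χ.tot = E.τ ψ.tot) :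
    gl (E.ξ₂₁ (E.T.obj a) (E.T.obj b) (E.T.obj c)) ≫ (E.c₂ θ χ).tot ≫ gl (E.κ₂ d d') =
      gl (E.κ₃ a b c) ≫ E.τ (gl (E.ξ₂₁ a b c) ≫ (E.c₂ φ ψ).tot) := by
  have e : (E.c₂ (Cell.ofHom (E.κ₂ a b)) (Cell.id (E.T.obj c))).tot ≫
      (E.c₂ (E.T.cell φ) (E.T.cell ψ)).tot = (E.c₂ θ χ).tot :=
    E.c₂_comp (by rw [hθ]; rfl) (by rw [hχ]; exact Category.id_comp _)
  rw [← e, Category.assoc, κ₂_natural, τ_comp, reassoc_of% κ₂₁]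

lemma paste₁₂ {d : Vec E.mod x₁ y₁} {d' : Vec E.mod y₁ w₁}
    {φ : Cell f₁ g₁ a d} {ψ : Cell g₁ k₁ (E.P₂ b c) d'}
    {θ : Cell fT gT (E.T.obj a) (E.T.obj d)}
    {χ : Cell gT kT (E.P₂ (E.T.obj b) (E.T.obj c)) (E.T.obj d')}
    (hθ : θ.tot = E.τ φ.tot) (hχ : χ.tot = gl (E.κ₂ b c) ≫ E.τ ψ.tot) :
    gl (E.ξ₁₂ (E.T.obj a) (E.T.obj b) (E.T.obj c)) ≫ (E.c₂ θ χ).tot ≫ gl (E.κ₂ d d') =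
      gl (E.κ₃ a b c) ≫ E.τ (gl (E.ξ₁₂ a b c) ≫ (E.c₂ φ ψ).tot) := by
  have e : (E.c₂ (Cell.id (E.T.obj a)) (Cell.ofHom (E.κ₂ b c))).tot ≫
      (E.c₂ (E.T.cell φ) (E.T.cell ψ)).tot = (E.c₂ θ χ).tot :=
    E.c₂_comp (by rw [hθ]; exact Category.id_comp _) (by rw [hχ]; rfl)
  rw [← e, Category.assoc, κ₂_natural, τ_comp, reassoc_of% κ₁₂]

lemma paste₀₁ {d : Vec E.mod x₁ z₁} {d' : Vec E.mod z₁ y₁} {h₁ : x ⟶ z₁}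
    {hT : E.T₀.obj x ⟶ E.T₀.obj z₁}
    {φ : Cell f₁ h₁ (E.i x) d} {ψ : Cell h₁ g₁ a d'}
    {θ : Cell fT hT (E.i (E.T₀.obj x)) (E.T.obj d)}
    {χ : Cell hT gT (E.T.obj a) (E.T.obj d')}
    (hθ : θ.tot = gl (E.κ₀ x) ≫ E.τ φ.tot) (hχ : χ.tot = E.τ ψ.tot) :
    gl (E.ξ₀₁ (E.T.obj a)) ≫ (E.c₂ θ χ).tot ≫ gl (E.κ₂ d d') =
      E.τ (gl (E.ξ₀₁ a) ≫ (E.c₂ φ ψ).tot) := by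
  have e : (E.c₂ (Cell.ofHom (E.κ₀ x)) (Cell.id (E.T.obj a))).tot ≫
      (E.c₂ (E.T.cell φ) (E.T.cell ψ)).tot = (E.c₂ θ χ).tot :=
    E.c₂_comp (by rw [hθ]; rfl) (by rw [hχ]; exact Category.id_comp _)
  rw [← e, Category.assoc, κ₂_natural, τ_comp, κ₀₁]
  simp only [Category.assoc]

lemma paste₁₀ {d : Vec E.mod x₁ z₁} {d' : Vec E.mod z₁ y₁} {h₁ : y ⟶ z₁}
    {hT : E.T₀.obj y ⟶ E.T₀.obj z₁}
    {φ : Cell f₁ h₁ a d} {ψ : Cell h₁ g₁ (E.i y) d'}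
    {θ : Cell fT hT (E.T.obj a) (E.T.obj d)}
    {χ : Cell hT gT (E.i (E.T₀.obj y)) (E.T.obj d')}
    (hθ : θ.tot = E.τ φ.tot) (hχ : χ.tot = gl (E.κ₀ y) ≫ E.τ ψ.tot) :
    gl (E.ξ₁₀ (E.T.obj a)) ≫ (E.c₂ θ χ).tot ≫ gl (E.κ₂ d d') =
      E.τ (gl (E.ξ₁₀ a) ≫ (E.c₂ φ ψ).tot) := by
  have e : (E.c₂ (Cell.id (E.T.obj a)) (Cell.ofHom (E.κ₀ y))).tot ≫
      (E.c₂ (E.T.cell φ) (E.T.cell ψ)).tot = (E.c₂ θ χ).tot :=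
    E.c₂_comp (by rw [hθ]; exact Category.id_comp _) (by rw [hχ]; rfl)
  rw [← e, Category.assoc, κ₂_natural, τ_comp, κ₁₀]
  simp only [Category.assoc]

end pasting

end TEquipment

/-- A monoid in an equipment: a vector `x ⇸ x` with a multiplication and a unit satisfying the
associativity and unit laws. -/
structure Mon (E : Equipment.{v₁, u₁} C) where
  pt : C
  vec : Vec E.mod pt pt
  mul : E.P₂ vec vec ⟶ vec
  one : E.i pt ⟶ vec
  assoc : E.ξ₂₁ vec vec vec ≫ (E.c₂ (Cell.ofHom mul) (Cell.id vec)).toHom ≫ mul =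
    E.ξ₁₂ vec vec vec ≫ (E.c₂ (Cell.id vec) (Cell.ofHom mul)).toHom ≫ mul
  one_mul : E.ξ₀₁ vec ≫ (E.c₂ (Cell.ofHom one) (Cell.id vec)).toHom ≫ mul = 𝟙 vec
  mul_one : E.ξ₁₀ vec ≫ (E.c₂ (Cell.id vec) (Cell.ofHom one)).toHom ≫ mul = 𝟙 vec

namespace Mon
variable {E : Equipment.{v₁, u₁} C}

lemma assoc' (X : Mon E) :
    gl (E.ξ₂₁ X.vec X.vec X.vec) ≫ (E.c₂ (Cell.ofHom X.mul) (Cell.id X.vec)).tot ≫ gl X.mul =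
      gl (E.ξ₁₂ X.vec X.vec X.vec) ≫ (E.c₂ (Cell.id X.vec) (Cell.ofHom X.mul)).tot ≫ gl X.mul := by
  simpa only [gl_comp, gl_toHom] using congrArg gl X.assoc

lemma one_mul' (X : Mon E) :
    gl (E.ξ₀₁ X.vec) ≫ (E.c₂ (Cell.ofHom X.one) (Cell.id X.vec)).tot ≫ gl X.mul = 𝟙 _ := by
  simpa only [gl_comp, gl_toHom, gl_id] using congrArg gl X.one_mul

lemma mul_one' (X : Mon E) :
    gl (E.ξ₁₀ X.vec) ≫ (E.c₂ (Cell.id X.vec) (Cell.ofHom X.one)).tot ≫ gl X.mul = 𝟙 _ := by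
  simpa only [gl_comp, gl_toHom, gl_id] using congrArg gl X.mul_one

/-- A homomorphism of monoids. -/
@[ext]
structure Hom (X Y : Mon E) where
  hom : X.pt ⟶ Y.pt
  cell : Cell hom hom X.vec Y.vec
  mul_comm : (E.c₂ cell cell).tot ≫ gl Y.mul = gl X.mul ≫ cell.tot
  one_comm : (E.toComp.unitCell hom).tot ≫ gl Y.one = gl X.one ≫ cell.tot

lemma Hom.ext_tot {X Y : Mon E} {F G : Hom X Y} (h : F.cell.tot = G.cell.tot) : F = G := by
  obtain ⟨f, φ, _, _⟩ := F
  obtain ⟨g, ψ, _, _⟩ := G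
  obtain rfl : f = g := congrArg Tot.Hom.left h
  obtain rfl := Cell.tot_inj h
  rfl

instance : Category (Mon E) where
  Hom := Hom
  id X := ⟨𝟙 _, Cell.id _, by
    rw [E.c₂_id]; exact (Category.id_comp _).trans (Category.comp_id _).symm, by
    rw [E.unitCell_id]; exact (Category.id_comp _).trans (Category.comp_id _).symm⟩
  comp F G := ⟨F.hom ≫ G.hom, F.cell.comp G.cell, by
    rw [← E.c₂_comp (φ := F.cell) (ψ := F.cell) (φ' := G.cell) (ψ' := G.cell)
      (Cell.tot_comp _ _).symm (Cell.tot_comp _ _).symm, Category.assoc, G.mul_comm, ← Category.assoc, F.mul_comm, Category.assoc]; rfl, by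
    rw [E.unitCell_comp, Category.assoc, G.one_comm, ← Category.assoc, F.one_comm,
      Category.assoc]; rfl⟩
  id_comp F := Hom.ext_tot (Category.id_comp F.cell.tot)
  comp_id F := Hom.ext_tot (Category.comp_id F.cell.tot)
  assoc F G H := Hom.ext_tot (Category.assoc F.cell.tot G.cell.tot H.cell.tot)

lemma hom_ext {X Y : Mon E} {F G : X ⟶ Y} (h : F.cell.tot = G.cell.tot) : F = G :=
  Hom.ext_tot h

@[simp] lemma id_tot (X : Mon E) : (Hom.cell (𝟙 X)).tot = 𝟙 _ := rfl
@[simp] lemma comp_tot {X Y Z : Mon E} (F : X ⟶ Y) (G : Y ⟶ Z) :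
    (Hom.cell (F ≫ G)).tot = F.cell.tot ≫ G.cell.tot := rfl

end Mon

namespace TEquipment
variable (E : TEquipment.{v₁, u₁} C)

/-- The image of a monoid under `T`, i.e. `(T x, T a)` with multiplication `κ₂ ≫ T μ` and unit
`κ₀ ≫ T η`. -/
@[reducible]
def monObj (X : Mon E.toEquipment) : Mon E.toEquipment where
  pt := E.T₀.obj X.pt
  vec := E.T.obj X.vec
  mul := E.κ₂ X.vec X.vec ≫ E.T.hom X.mul
  one := E.κ₀ X.pt ≫ E.T.hom X.one
  assoc := gl_inj <| by
    have h1 : (Cell.id (E.T.obj X.vec)).tot = E.τ (Cell.id X.vec).tot := (E.τ_id _).symm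
    have h2 : (Cell.ofHom (E.κ₂ X.vec X.vec ≫ E.T.hom X.mul)).tot =
      gl (E.κ₂ X.vec X.vec) ≫ E.τ (Cell.ofHom X.mul).tot := by simp [gl_comp, gl_T_hom]
    simp only [gl_comp, gl_toHom, gl_T_hom]
    rw [reassoc_of% E.paste₂₁ h2 h1, reassoc_of% E.paste₁₂ h1 h2]
    simp only [← τ_comp, Category.assoc, X.assoc']
  one_mul := gl_inj <| by
    have h1 : (Cell.id (E.T.obj X.vec)).tot = E.τ (Cell.id X.vec).tot := (E.τ_id _).symm
    have h2 : (Cell.ofHom (E.κ₀ X.pt ≫ E.T.hom X.one)).tot =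
      gl (E.κ₀ X.pt) ≫ E.τ (Cell.ofHom X.one).tot := by simp [gl_comp, gl_T_hom]
    simp only [gl_comp, gl_toHom, gl_T_hom, gl_id]
    rw [reassoc_of% E.paste₀₁ h2 h1, ← τ_comp, Category.assoc, X.one_mul', τ_id]
  mul_one := gl_inj <| by
    have h1 : (Cell.id (E.T.obj X.vec)).tot = E.τ (Cell.id X.vec).tot := (E.τ_id _).symm
    have h2 : (Cell.ofHom (E.κ₀ X.pt ≫ E.T.hom X.one)).tot =
      gl (E.κ₀ X.pt) ≫ E.τ (Cell.ofHom X.one).tot := by simp [gl_comp, gl_T_hom]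
    simp only [gl_comp, gl_toHom, gl_T_hom, gl_id]
    rw [reassoc_of% E.paste₁₀ h1 h2, ← τ_comp, Category.assoc, X.mul_one', τ_id]

@[simp] lemma gl_monObj_mul (X : Mon E.toEquipment) :
    gl (E.monObj X).mul = gl (E.κ₂ X.vec X.vec) ≫ E.τ (gl X.mul) := by
  simp only [monObj, gl_comp, gl_T_hom]

@[simp] lemma gl_monObj_one (X : Mon E.toEquipment) :
    gl (E.monObj X).one = gl (E.κ₀ X.pt) ≫ E.τ (gl X.one) := by
  simp only [monObj, gl_comp, gl_T_hom]

lemma τ_mul {X Y : Mon E.toEquipment} (F : X ⟶ Y) :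
    (E.c₂ (E.T.cell F.cell) (E.T.cell F.cell)).tot ≫ gl (E.κ₂ Y.vec Y.vec) ≫ E.τ (gl Y.mul) =
      (gl (E.κ₂ X.vec X.vec) ≫ E.τ (gl X.mul)) ≫ E.τ F.cell.tot := by
  have h := E.κ₂_natural F.cell F.cell
  rw [reassoc_of% h, ← τ_comp, F.mul_comm, τ_comp, Category.assoc]

lemma τ_one {X Y : Mon E.toEquipment} (F : X ⟶ Y) :
    (E.toComp.unitCell (E.T₀.map F.hom)).tot ≫ gl (E.κ₀ Y.pt) ≫ E.τ (gl Y.one) =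
      (gl (E.κ₀ X.pt) ≫ E.τ (gl X.one)) ≫ E.τ F.cell.tot := by
  have h := E.κ₀_natural F.hom
  rw [reassoc_of% h, ← τ_comp, F.one_comm, τ_comp, Category.assoc]

/-- The image of a monoid homomorphism under `T`. -/
@[reducible]
def monMap {X Y : Mon E.toEquipment} (F : X ⟶ Y) : E.monObj X ⟶ E.monObj Y where
  hom := E.T₀.map F.hom
  cell := E.T.cell F.cell
  mul_comm := (congrArg (_ ≫ ·) (E.gl_monObj_mul Y)).trans
    ((E.τ_mul F).trans (congrArg (· ≫ _) (E.gl_monObj_mul X)).symm)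
  one_comm := (congrArg (_ ≫ ·) (E.gl_monObj_one Y)).trans
    ((E.τ_one F).trans (congrArg (· ≫ _) (E.gl_monObj_one X)).symm)

lemma νe_mul (X : Mon E.toEquipment) :
    (E.c₂ (E.νe X.vec) (E.νe X.vec)).tot ≫ gl (E.κ₂ X.vec X.vec) ≫ E.τ (gl X.mul) =
      gl X.mul ≫ (E.νe X.vec).tot := by
  have h := E.νe_κ₂ X.vec X.vec
  rw [reassoc_of% h]
  exact (E.νe_nat (Cell.ofHom X.mul)).symm

lemma νe_one (X : Mon E.toEquipment) :
    (E.toComp.unitCell (E.T₀.η.app X.pt)).tot ≫ gl (E.κ₀ X.pt) ≫ E.τ (gl X.one) =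
      gl X.one ≫ (E.νe X.vec).tot := by
  have h := E.νe_κ₀ X.pt
  rw [reassoc_of% h]
  exact (E.νe_nat (Cell.ofHom X.one)).symm

lemma νm_mul (X : Mon E.toEquipment) :
    (E.c₂ (E.νm X.vec) (E.νm X.vec)).tot ≫ gl (E.κ₂ X.vec X.vec) ≫ E.τ (gl X.mul) =
      (gl (E.κ₂ (E.T.obj X.vec) (E.T.obj X.vec)) ≫
        E.τ (gl (E.κ₂ X.vec X.vec) ≫ E.τ (gl X.mul))) ≫ (E.νm X.vec).tot := by
  have h := E.νm_κ₂ X.vec X.vec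
  have h' := E.νm_nat (Cell.ofHom X.mul)
  rw [tot_ofHom] at h'
  rw [reassoc_of% h, τ_comp, Category.assoc, Category.assoc, h']

lemma νm_one (X : Mon E.toEquipment) :
    (E.toComp.unitCell (E.T₀.μ.app X.pt)).tot ≫ gl (E.κ₀ X.pt) ≫ E.τ (gl X.one) =
      (gl (E.κ₀ (E.T₀.obj X.pt)) ≫ E.τ (gl (E.κ₀ X.pt) ≫ E.τ (gl X.one))) ≫
        (E.νm X.vec).tot := by
  have h := E.νm_κ₀ X.pt
  have h' := E.νm_nat (Cell.ofHom X.one)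
  rw [tot_ofHom] at h'
  rw [reassoc_of% h, τ_comp, Category.assoc, Category.assoc, h']

/-- The monoid homomorphism `(e_x, νe_a)`. -/
@[reducible]
def monUnit (X : Mon E.toEquipment) : X ⟶ E.monObj X where
  hom := E.T₀.η.app X.pt
  cell := E.νe X.vec
  mul_comm := (congrArg (_ ≫ ·) (E.gl_monObj_mul X)).trans (E.νe_mul X)
  one_comm := (congrArg (_ ≫ ·) (E.gl_monObj_one X)).trans (E.νe_one X)

/-- The monoid homomorphism `(m_x, νm_a)`. -/
@[reducible]
def monMul (X : Mon E.toEquipment) : E.monObj (E.monObj X) ⟶ E.monObj X where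
  hom := E.T₀.μ.app X.pt
  cell := E.νm X.vec
  mul_comm := (congrArg (_ ≫ ·) (E.gl_monObj_mul X)).trans ((E.νm_mul X).trans
    (congrArg (· ≫ _) ((E.gl_monObj_mul _).trans
      (congrArg (fun t => _ ≫ E.τ t) (E.gl_monObj_mul X)))).symm)
  one_comm := (congrArg (_ ≫ ·) (E.gl_monObj_one X)).trans ((E.νm_one X).trans
    (congrArg (· ≫ _) ((E.gl_monObj_one _).trans
      (congrArg (fun t => _ ≫ E.τ t) (E.gl_monObj_one X)))).symm)

/-- The monad on the category of monoids induced by a `T`-equipment. -/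
@[reducible]
def monMonad : Monad (Mon E.toEquipment) where
  obj := E.monObj
  map F := E.monMap F
  map_id X := Mon.hom_ext (E.τ_id X.vec)
  map_comp F G := Mon.hom_ext (E.τ_comp F.cell.tot G.cell.tot)
  η :=
    { app X := E.monUnit X
      naturality X Y F := Mon.hom_ext (E.νe_nat F.cell) }
  μ :=
    { app X := E.monMul X
      naturality X Y F := Mon.hom_ext (E.νm_nat F.cell) }
  assoc X := Mon.hom_ext (E.νm_assoc X.vec)
  left_unit X := Mon.hom_ext (E.νe_νm X.vec)
  right_unit X := Mon.hom_ext (E.T_νe_νm X.vec)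

/-- The category of `T`-algebras: the Eilenberg–Moore algebras of the induced monad on monoids. -/
abbrev TAlgebra := E.monMonad.Algebra

end TEquipment

/-- A `T`-monoid, i.e. a monoid in the Kleisli equipment: a vector `a : x ⇸ T x` with a multiplication
`m_x (a, T a) ⟶ a` and a unit `e_x i_x ⟶ a`, subject to the associativity and unit laws. The laws involve the
components of the Kleisli associator at the partitions `2 + 1`, `1 + 2`, `0 + 1`, `1 + 0`, which are built
from `ξ` and `νm`, `κ₂`, `νe`, `κ₀` respectively. -/
structure TMon (E : TEquipment.{v₁, u₁} C) where
  pt : C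
  vec : Vec E.mod pt (E.T₀.obj pt)
  mul : Cell (𝟙 pt) (E.T₀.μ.app pt) (E.P₂ vec (E.T.obj vec)) vec
  one : Cell (𝟙 pt) (E.T₀.η.app pt) (E.i pt) vec
  assoc : gl (E.ξ₂₁ vec (E.T.obj vec) (E.T.obj (E.T.obj vec))) ≫
      (E.c₂ mul (E.νm vec)).tot ≫ mul.tot =
    gl (E.ξ₁₂ vec (E.T.obj vec) (E.T.obj (E.T.obj vec))) ≫
      (E.c₂ (Cell.id vec) (((Cell.ofHom (E.κ₂ vec (E.T.obj vec))).comp (E.T.cell mul)).copy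
        (h := 𝟙 _) (k := E.T₀.map (E.T₀.μ.app pt)) (by simp) (by simp))).tot ≫ mul.tot
  one_mul : gl (E.ξ₀₁ vec) ≫ (E.c₂ one (E.νe vec)).tot ≫ mul.tot = 𝟙 _
  mul_one : gl (E.ξ₁₀ vec) ≫ (E.c₂ (Cell.id vec) (((Cell.ofHom (E.κ₀ _)).comp (E.T.cell one)).copy
        (h := 𝟙 _) (k := E.T₀.map (E.T₀.η.app pt)) (by simp) (by simp))).tot ≫ mul.tot = 𝟙 _

namespace TMon
variable {E : TEquipment.{v₁, u₁} C}

/-- A homomorphism of `T`-monoids. -/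
@[ext]
structure Hom (X Y : TMon E) where
  hom : X.pt ⟶ Y.pt
  cell : Cell hom (E.T₀.map hom) X.vec Y.vec
  mul_comm : (E.c₂ cell (E.T.cell cell)).tot ≫ Y.mul.tot = X.mul.tot ≫ cell.tot
  one_comm : (E.toComp.unitCell hom).tot ≫ Y.one.tot = X.one.tot ≫ cell.tot

lemma Hom.ext_tot {X Y : TMon E} {F G : Hom X Y} (h : F.cell.tot = G.cell.tot) : F = G := by
  obtain ⟨f, φ, _, _⟩ := F
  obtain ⟨g, ψ, _, _⟩ := G
  obtain rfl : f = g := congrArg Tot.Hom.left h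
  obtain rfl := Cell.tot_inj h
  rfl

/-- The identity homomorphism of `T`-monoids. -/
def Hom.id (X : TMon E) : Hom X X where
  hom := 𝟙 _
  cell := (Cell.id _).copy rfl (E.T₀.map_id _).symm
  mul_comm := by
    have h : ((Cell.id X.vec).copy rfl (E.T₀.map_id X.pt).symm).tot = 𝟙 _ := Cell.tot_copy _ _ _
    rw [E.c₂_congr (φ₁ := Cell.id X.vec) (ψ₁ := Cell.id (E.T.obj X.vec)) h
      (by rw [E.τ_map, h, E.τ_id]; rfl), E.c₂_id, h]
    exact (Category.id_comp _).trans (Category.comp_id _).symm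
  one_comm := by
    have h : ((Cell.id X.vec).copy rfl (E.T₀.map_id X.pt).symm).tot = 𝟙 _ := Cell.tot_copy _ _ _
    rw [E.unitCell_id, h]; exact (Category.id_comp _).trans (Category.comp_id _).symm

/-- Composition of homomorphisms of `T`-monoids. -/
def Hom.comp {X Y Z : TMon E} (F : Hom X Y) (G : Hom Y Z) : Hom X Z where
  hom := F.hom ≫ G.hom
  cell := (F.cell.comp G.cell).copy rfl (E.T₀.map_comp _ _).symm
  mul_comm := by
    have h : ((F.cell.comp G.cell).copy rfl (E.T₀.map_comp F.hom G.hom).symm).tot =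
      F.cell.tot ≫ G.cell.tot := Cell.tot_copy _ _ _
    rw [← E.c₂_comp (φ := F.cell) (ψ := E.T.cell F.cell) (φ' := G.cell) (ψ' := E.T.cell G.cell)
      h.symm (by rw [E.τ_map, E.τ_map, E.τ_map, h, E.τ_comp]), Category.assoc, G.mul_comm,
      ← Category.assoc, F.mul_comm, Category.assoc, h]
  one_comm := by
    have h : ((F.cell.comp G.cell).copy rfl (E.T₀.map_comp F.hom G.hom).symm).tot =
      F.cell.tot ≫ G.cell.tot := Cell.tot_copy _ _ _
    rw [E.unitCell_comp, Category.assoc, G.one_comm, ← Category.assoc, F.one_comm,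
      Category.assoc, h]

lemma Hom.id_tot (X : TMon E) : (Hom.id X).cell.tot = 𝟙 _ :=
  Cell.tot_copy (Cell.id X.vec) rfl (E.T₀.map_id _).symm
lemma Hom.comp_tot {X Y Z : TMon E} (F : Hom X Y) (G : Hom Y Z) :
    (Hom.comp F G).cell.tot = F.cell.tot ≫ G.cell.tot :=
  Cell.tot_copy (F.cell.comp G.cell) rfl (E.T₀.map_comp _ _).symm

instance : Category (TMon E) where
  Hom := Hom
  id := Hom.id
  comp := Hom.comp
  id_comp F := Hom.ext_tot <| by rw [Hom.comp_tot, Hom.id_tot, Category.id_comp]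
  comp_id F := Hom.ext_tot <| by rw [Hom.comp_tot, Hom.id_tot, Category.comp_id]
  assoc F G H := Hom.ext_tot <| by
    rw [Hom.comp_tot, Hom.comp_tot, Hom.comp_tot, Hom.comp_tot, Category.assoc]

lemma hom_ext {X Y : TMon E} {F G : X ⟶ Y} (h : F.cell.tot = G.cell.tot) : F = G :=
  Hom.ext_tot h

lemma id_tot (X : TMon E) : (Hom.cell (𝟙 X)).tot = 𝟙 _ := Hom.id_tot X
lemma comp_tot {X Y Z : TMon E} (F : X ⟶ Y) (G : Y ⟶ Z) :
    (Hom.cell (F ≫ G)).tot = F.cell.tot ≫ G.cell.tot := Hom.comp_tot F G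

end TMon

namespace TEquipment
variable (E : TEquipment.{v₁, u₁} C)

/-- The multiplication of the monad of scalars. -/
abbrev m (x : C) : E.T₀.obj (E.T₀.obj x) ⟶ E.T₀.obj x := E.T₀.μ.app x
/-- The unit of the monad of scalars. -/
abbrev e (x : C) : x ⟶ E.T₀.obj x := E.T₀.η.app x

/-- `νm` is invertible: each 2-cell `m_y (T T a) ⟶ (T a) m_x` is an isomorphism. -/
def MulInvertible : Prop := ∀ ⦃x y : C⦄ (a : Vec E.mod x y), (E.νm a).Invertible

end TEquipment

lemma TEquipment.τ_comp_assoc (E : TEquipment.{v₁, u₁} C) {x y x' y' x'' y'' : C}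
    {a : Vec E.mod x y} {a' : Vec E.mod x' y'} {a'' : Vec E.mod x'' y''}
    (φ : Tot.mk a ⟶ Tot.mk a') (ψ : Tot.mk a' ⟶ Tot.mk a'') {Z : Tot E.mod} (h : _ ⟶ Z) :
    E.τ (φ ≫ ψ) ≫ h = E.τ φ ≫ E.τ ψ ≫ h := by rw [E.τ_comp, Category.assoc]

namespace TMon
variable {E : TEquipment.{v₁, u₁} C}

section
variable (X : TMon E)

/-- The vector `m_x (T a) : T x ⇸ T x`. -/
@[reducible]
def freeVec : Vec E.mod (E.T₀.obj X.pt) (E.T₀.obj X.pt) :=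
  (act E.mod (post _ (E.m X.pt))).obj (E.T.obj X.vec)

/-- The invertible cell from `T a` to `m_x (T a)` with right boundary `m_x`. -/
def ι : Cell (𝟙 (E.T₀.obj X.pt)) (E.m X.pt) (E.T.obj X.vec) X.freeVec :=
  Cell.pushCell (E.T.obj X.vec) (E.m X.pt)

lemma ι_invertible : X.ι.Invertible := Cell.pushCell_invertible _ _

/-- The cell from `T T a` to `m_x (T a)` obtained by composing `νm_a` with `ι`. -/
def νι : Cell (E.m X.pt) (E.m (E.T₀.obj X.pt) ≫ E.m X.pt) (E.T.obj (E.T.obj X.vec)) X.freeVec :=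
  ((E.νm X.vec).comp X.ι).copy (Category.comp_id _) rfl

lemma tot_νι : X.νι.tot = (E.νm X.vec).tot ≫ X.ι.tot := Cell.tot_copy _ _ _

/-- The horizontal composite of `ι` and `νι`; it is invertible when `νm` is. -/
def Ψ : Cell (𝟙 (E.T₀.obj X.pt)) (E.m (E.T₀.obj X.pt) ≫ E.m X.pt)
    (E.P₂ (E.T.obj X.vec) (E.T.obj (E.T.obj X.vec))) (E.P₂ X.freeVec X.freeVec) :=
  E.c₂ X.ι X.νι

/-- The cell `κ₂` followed by `T μ` and `ι`, from `P₂ (T a) (T T a)` to `m_x (T a)`. -/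
def preMul : Cell (𝟙 (E.T₀.obj X.pt)) (E.m (E.T₀.obj X.pt) ≫ E.m X.pt)
    (E.P₂ (E.T.obj X.vec) (E.T.obj (E.T.obj X.vec))) X.freeVec :=
  ((Cell.ofHom (E.κ₂ _ _)).comp ((E.T.cell X.mul).comp X.ι)).copy (by simp)
    (by simp [E.T₀.assoc X.pt])

lemma tot_preMul : X.preMul.tot = gl (E.κ₂ _ _) ≫ E.τ X.mul.tot ≫ X.ι.tot := Cell.tot_copy _ _ _

/-- The cell `κ₀` followed by `T η` and `ι`. -/
def freeOneCell : Cell (𝟙 (E.T₀.obj X.pt)) (𝟙 (E.T₀.obj X.pt)) (E.i (E.T₀.obj X.pt)) X.freeVec :=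
  ((Cell.ofHom (E.κ₀ _)).comp ((E.T.cell X.one).comp X.ι)).copy (by simp)
    (by simpa using E.T₀.right_unit X.pt)

lemma tot_freeOneCell : X.freeOneCell.tot = gl (E.κ₀ _) ≫ E.τ X.one.tot ≫ X.ι.tot :=
  Cell.tot_copy _ _ _

/-- The unit of the monoid `(T x, m_x (T a))`. -/
def freeOne : E.i (E.T₀.obj X.pt) ⟶ X.freeVec := X.freeOneCell.toHom

lemma gl_freeOne : gl X.freeOne = gl (E.κ₀ _) ≫ E.τ X.one.tot ≫ X.ι.tot :=
  (gl_toHom _).trans X.tot_freeOneCell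

/-- The cell `κ₂` followed by `T μ`. -/
def Tmul : Cell (𝟙 (E.T₀.obj X.pt)) (E.T₀.map (E.m X.pt))
    (E.P₂ (E.T.obj X.vec) (E.T.obj (E.T.obj X.vec))) (E.T.obj X.vec) :=
  ((Cell.ofHom (E.κ₂ X.vec (E.T.obj X.vec))).comp (E.T.cell X.mul)).copy (by simp) (by simp)

lemma tot_Tmul : X.Tmul.tot = gl (E.κ₂ _ _) ≫ E.τ X.mul.tot := Cell.tot_copy _ _ _

/-- The cell `κ₀` followed by `T η`. -/
def Tone : Cell (𝟙 (E.T₀.obj X.pt)) (E.T₀.map (E.e X.pt))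
    (E.i (E.T₀.obj X.pt)) (E.T.obj X.vec) :=
  ((Cell.ofHom (E.κ₀ X.pt)).comp (E.T.cell X.one)).copy (by simp) (by simp)

lemma tot_Tone : X.Tone.tot = gl (E.κ₀ _) ≫ E.τ X.one.tot := Cell.tot_copy _ _ _

lemma assoc' : gl (E.ξ₂₁ X.vec (E.T.obj X.vec) (E.T.obj (E.T.obj X.vec))) ≫
      (E.c₂ X.mul (E.νm X.vec)).tot ≫ X.mul.tot =
    gl (E.ξ₁₂ X.vec (E.T.obj X.vec) (E.T.obj (E.T.obj X.vec))) ≫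
      (E.c₂ (Cell.id X.vec) X.Tmul).tot ≫ X.mul.tot := X.assoc

lemma mul_one' : gl (E.ξ₁₀ X.vec) ≫ (E.c₂ (Cell.id X.vec) X.Tone).tot ≫ X.mul.tot = 𝟙 _ :=
  X.mul_one

/-- The cell from `T T T a` to `m_x (T a)` obtained from `νm` and `ι`. -/
def ννι : Cell (E.m (E.T₀.obj X.pt) ≫ E.m X.pt)
    (E.m (E.T₀.obj (E.T₀.obj X.pt)) ≫ E.m (E.T₀.obj X.pt) ≫ E.m X.pt)
    (E.T.obj (E.T.obj (E.T.obj X.vec))) X.freeVec :=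
  (E.νm (E.T.obj X.vec)).comp X.νι

lemma tot_ννι : X.ννι.tot = (E.νm (E.T.obj X.vec)).tot ≫ (E.νm X.vec).tot ≫ X.ι.tot := by
  rw [← tot_νι]; exact Cell.tot_comp _ _

end

section
variable (X : TMon E) (hν : E.MulInvertible)

lemma νι_invertible (X : TMon E) (hν : E.MulInvertible) : X.νι.Invertible :=
  Cell.Invertible.copy (Cell.Invertible.comp (hν _) X.ι_invertible) _ _

lemma Ψ_invertible (X : TMon E) (hν : E.MulInvertible) : X.Ψ.Invertible :=
  E.c₂_invertible X.ι_invertible (X.νι_invertible hν)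

lemma ννι_invertible (X : TMon E) (hν : E.MulInvertible) : X.ννι.Invertible :=
  Cell.Invertible.comp (hν _) (X.νι_invertible hν)

/-- The multiplication of the monoid `(T x, m_x (T a))`: the 2-cell obtained from `κ₂` followed by
`T μ` by means of the inverse of `νm`; it is determined by `Ψ_freeMul`. -/
noncomputable def freeMul : E.P₂ X.freeVec X.freeVec ⟶ X.freeVec :=
  (Cell.desc X.Ψ (X.Ψ_invertible hν) X.preMul (𝟙 _) (Category.comp_id _)).toHom

lemma Ψ_freeMul : X.Ψ.tot ≫ gl (X.freeMul hν) = gl (E.κ₂ _ _) ≫ E.τ X.mul.tot ≫ X.ι.tot := by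
  rw [freeMul, gl_toHom, Cell.tot_desc, tot_preMul]

lemma c₂_freeMul : (E.c₂ X.ι X.νι).tot ≫ gl (X.freeMul hν) =
    gl (E.κ₂ _ _) ≫ E.τ X.mul.tot ≫ X.ι.tot := X.Ψ_freeMul hν

lemma c₂_νι_freeMul : (E.c₂ X.νι X.ννι).tot ≫ gl (X.freeMul hν) =
    gl (E.κ₂ (E.T.obj X.vec) (E.T.obj (E.T.obj X.vec))) ≫ E.τ X.Tmul.tot ≫ X.νι.tot := by
  have e1 : (E.c₂ (E.νm X.vec) (E.νm (E.T.obj X.vec))).tot ≫ (E.c₂ X.ι X.νι).tot =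
    (E.c₂ X.νι X.ννι).tot := E.c₂_comp X.tot_νι.symm (by rw [tot_ννι, tot_νι])
  have e2 := E.νm_κ₂ X.vec (E.T.obj X.vec)
  rw [← e1, Category.assoc, c₂_freeMul, reassoc_of% e2, tot_Tmul, tot_νι, E.τ_comp,
    Category.assoc, reassoc_of% E.νm_nat X.mul]

lemma unitCell_freeOne : (E.toComp.unitCell (E.m X.pt)).tot ≫ gl X.freeOne =
    gl (E.κ₀ (E.T₀.obj X.pt)) ≫ E.τ X.Tone.tot ≫ X.νι.tot := by
  have e2 := E.νm_κ₀ X.pt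
  rw [gl_freeOne, reassoc_of% e2, tot_Tone, tot_νι, E.τ_comp,
    Category.assoc, reassoc_of% E.νm_nat X.one]

/-- The underlying monoid `(T x, m_x (T a))` of the free `T`-algebra on a `T`-monoid `(x, a)`. -/
@[reducible]
noncomputable def free : Mon E.toEquipment where
  pt := E.T₀.obj X.pt
  vec := X.freeVec
  mul := X.freeMul hν
  one := X.freeOne
  assoc := by
    refine gl_inj (Cell.tot_epi (E.c₃ X.ι X.νι X.ννι) (E.c₃_invertible X.ι_invertible
      (X.νι_invertible hν) (X.ννι_invertible hν)) (Cell.ofHom _) (Cell.ofHom _) rfl ?_)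
    simp only [tot_ofHom, gl_comp, gl_toHom]
    have e1 : (E.c₂ (E.c₂ X.ι X.νι) X.ννι).tot ≫
        (E.c₂ (Cell.ofHom (X.freeMul hν)) (Cell.id _)).tot = (E.c₂ X.preMul X.ννι).tot :=
      E.c₂_comp (by rw [tot_ofHom, c₂_freeMul, tot_preMul]) (Category.comp_id _)
    have e2 : (E.c₂ X.Tmul (E.T.cell (E.νm X.vec))).tot ≫ (E.c₂ X.ι X.νι).tot =
        (E.c₂ X.preMul X.ννι).tot :=
      E.c₂_comp (by rw [tot_Tmul, tot_preMul, Category.assoc])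
        (by rw [E.τ_map, tot_νι, tot_ννι, reassoc_of% E.νm_assoc])
    have e3 := E.paste₂₁ (φ := X.mul) (ψ := E.νm X.vec) (θ := X.Tmul)
      (χ := E.T.cell (E.νm X.vec)) X.tot_Tmul rfl
    let R : Cell (E.m X.pt) _ _ _ := ((E.c₂ X.νι X.ννι).comp (Cell.ofHom (X.freeMul hν))).copy
      (Category.comp_id _) rfl
    have hR : R.tot = (E.c₂ X.νι X.ννι).tot ≫ gl (X.freeMul hν) := Cell.tot_copy _ _ _
    let TX : Cell (𝟙 _) (E.T₀.map (E.T₀.map (E.m X.pt))) _ _ :=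
      ((Cell.ofHom (E.κ₂ (E.T.obj X.vec) (E.T.obj (E.T.obj X.vec)))).comp (E.T.cell X.Tmul)).copy
        (by simp) (by simp)
    have hTX : TX.tot = gl (E.κ₂ _ _) ≫ E.τ X.Tmul.tot := Cell.tot_copy _ _ _
    have f1 : (E.c₂ X.ι (E.c₂ X.νι X.ννι)).tot ≫
        (E.c₂ (Cell.id _) (Cell.ofHom (X.freeMul hν))).tot = (E.c₂ X.ι R).tot :=
      E.c₂_comp (Category.comp_id _) hR.symm
    have f2 : (E.c₂ (Cell.id _) TX).tot ≫ (E.c₂ X.ι X.νι).tot = (E.c₂ X.ι R).tot :=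
      E.c₂_comp (Category.id_comp _) (by rw [hR, hTX, c₂_νι_freeMul, Category.assoc])
    have f3 := E.paste₁₂ (φ := Cell.id X.vec) (ψ := X.Tmul) (θ := Cell.id (E.T.obj X.vec))
      (χ := TX) (E.τ_id _).symm hTX
    rw [reassoc_of% E.ξ₂₁_natural, reassoc_of% E.ξ₁₂_natural, reassoc_of% e1, ← e2,
      reassoc_of% f1, ← f2, Category.assoc, Category.assoc, c₂_freeMul, reassoc_of% e3,
      reassoc_of% f3]
    simp only [← E.τ_comp_assoc, Category.assoc, X.assoc']
  one_mul := by
    refine gl_inj (Cell.tot_epi X.ι X.ι_invertible (Cell.ofHom _) (Cell.ofHom _) rfl ?_)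
    simp only [tot_ofHom, gl_comp, gl_toHom, gl_id]
    have e1 : (E.c₂ (E.toComp.unitCell (𝟙 _)) X.ι).tot ≫
        (E.c₂ (Cell.ofHom X.freeOne) (Cell.id _)).tot = (E.c₂ X.freeOneCell X.ι).tot :=
      E.c₂_comp (by rw [E.unitCell_id, Category.id_comp, tot_ofHom, freeOne, gl_toHom])
        (Category.comp_id _)
    have e2 : (E.c₂ X.Tone (E.T.cell (E.νe X.vec))).tot ≫ (E.c₂ X.ι X.νι).tot =
        (E.c₂ X.freeOneCell X.ι).tot :=
      E.c₂_comp (by rw [tot_Tone, tot_freeOneCell, Category.assoc])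
        (by rw [E.τ_map, tot_νι, reassoc_of% E.T_νe_νm])
    have e3 := E.paste₀₁ (φ := X.one) (ψ := E.νe X.vec) (θ := X.Tone)
      (χ := E.T.cell (E.νe X.vec)) X.tot_Tone rfl
    rw [reassoc_of% E.ξ₀₁_natural, reassoc_of% e1, ← e2, Category.assoc, c₂_freeMul,
      reassoc_of% e3, ← E.τ_comp_assoc, Category.assoc, X.one_mul, E.τ_id, Category.id_comp,
      Category.comp_id]
  mul_one := by
    refine gl_inj (Cell.tot_epi X.ι X.ι_invertible (Cell.ofHom _) (Cell.ofHom _) rfl ?_)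
    simp only [tot_ofHom, gl_comp, gl_toHom, gl_id]
    let R : Cell (E.m X.pt) (E.m X.pt) _ _ :=
      ((E.toComp.unitCell (E.m X.pt)).comp (Cell.ofHom X.freeOne)).copy
      (Category.comp_id _) (Category.comp_id _)
    have hR : R.tot = (E.toComp.unitCell (E.m X.pt)).tot ≫ gl X.freeOne := Cell.tot_copy _ _ _
    let TX : Cell (𝟙 _) (E.T₀.map (E.T₀.map (E.e X.pt))) _ _ :=
      ((Cell.ofHom (E.κ₀ _)).comp (E.T.cell X.Tone)).copy (by simp) (by simp)
    have hTX : TX.tot = gl (E.κ₀ _) ≫ E.τ X.Tone.tot := Cell.tot_copy _ _ _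
    have f1 : (E.c₂ X.ι (E.toComp.unitCell (E.m X.pt))).tot ≫
        (E.c₂ (Cell.id _) (Cell.ofHom X.freeOne)).tot = (E.c₂ X.ι R).tot :=
      E.c₂_comp (Category.comp_id _) hR.symm
    have f2 : (E.c₂ (Cell.id _) TX).tot ≫ (E.c₂ X.ι X.νι).tot = (E.c₂ X.ι R).tot :=
      E.c₂_comp (Category.id_comp _) (by rw [hR, hTX, unitCell_freeOne, Category.assoc])
    have f3 := E.paste₁₀ (φ := Cell.id X.vec) (ψ := X.Tone) (θ := Cell.id (E.T.obj X.vec))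
      (χ := TX) (E.τ_id _).symm hTX
    rw [reassoc_of% E.ξ₁₀_natural, reassoc_of% f1, ← f2, Category.assoc, c₂_freeMul,
      reassoc_of% f3, ← E.τ_comp_assoc, Category.assoc, X.mul_one', E.τ_id, Category.id_comp,
      Category.comp_id]

/-- The structure cell `T (m_x (T a)) ⟶ m_x (T a)` of the free `T`-algebra, induced by `νm_a`. -/
noncomputable def freeσ : Cell (E.m X.pt) (E.m X.pt) (E.T.obj X.freeVec) X.freeVec :=
  Cell.desc ((E.T.cell X.ι).copy (E.T₀.map_id _) rfl)
    (Cell.Invertible.copy (E.T.cell_invertible _ X.ι_invertible) _ _) X.νι (E.m X.pt)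
    (E.T₀.assoc X.pt)

lemma T_ι_freeσ : E.τ X.ι.tot ≫ X.freeσ.tot = (E.νm X.vec).tot ≫ X.ι.tot := by
  rw [← tot_νι, ← Cell.tot_desc ((E.T.cell X.ι).copy (E.T₀.map_id _) rfl) _ X.νι (E.m X.pt)
    (E.T₀.assoc X.pt), Cell.tot_copy]
  rfl

variable {X}

lemma T_ι_epi {x' y' : C} {c : Vec E.mod x' y'} {f f' : _} {h h' : _}
    (φ : Cell f h (E.T.obj X.freeVec) c) (φ' : Cell f' h' (E.T.obj X.freeVec) c) (hh : h = h')
    (H : E.τ X.ι.tot ≫ φ.tot = E.τ X.ι.tot ≫ φ'.tot) : φ.tot = φ'.tot := by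
  have hc : ((E.T.cell X.ι).copy (E.T₀.map_id _) rfl).tot = E.τ X.ι.tot := Cell.tot_copy _ _ _
  exact Cell.tot_epi ((E.T.cell X.ι).copy (E.T₀.map_id _) rfl)
    (Cell.Invertible.copy (E.T.cell_invertible _ X.ι_invertible) _ _) _ _ hh
    (by rw [hc]; exact H)

lemma T_Ψ_freeMul : (E.c₂ (E.T.cell X.ι) (E.T.cell X.νι)).tot ≫ gl (E.κ₂ X.freeVec X.freeVec) ≫
    E.τ (gl (X.freeMul hν)) = gl (E.κ₂ _ _) ≫ E.τ X.Tmul.tot ≫ E.τ X.ι.tot := by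
  have h := E.κ₂_natural X.ι X.νι
  rw [reassoc_of% h, ← E.τ_comp, c₂_freeMul, ← E.τ_comp, tot_Tmul, Category.assoc]

variable (X)

lemma freeσ_mul : (E.c₂ X.freeσ X.freeσ).tot ≫ gl (X.freeMul hν) =
    (gl (E.κ₂ X.freeVec X.freeVec) ≫ E.τ (gl (X.freeMul hν))) ≫ X.freeσ.tot := by
  let Tι : Cell (𝟙 _) (E.T₀.map (E.m X.pt)) (E.T.obj (E.T.obj X.vec)) (E.T.obj X.freeVec) :=
    (E.T.cell X.ι).copy (E.T₀.map_id _) rfl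
  have hι : Tι.tot = E.τ X.ι.tot := Cell.tot_copy _ _ _
  have hΘ : (E.c₂ Tι (E.T.cell X.νι)).Invertible := E.c₂_invertible
    (Cell.Invertible.copy (E.T.cell_invertible _ X.ι_invertible) _ _)
    (E.T.cell_invertible _ (X.νι_invertible hν))
  have e0 : (E.c₂ Tι (E.T.cell X.νι)).tot = (E.c₂ (E.T.cell X.ι) (E.T.cell X.νι)).tot :=
    E.c₂_congr hι rfl
  have e1 : (E.c₂ Tι (E.T.cell X.νι)).tot ≫ (E.c₂ X.freeσ X.freeσ).tot =
      (E.c₂ X.νι X.ννι).tot :=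
    E.c₂_comp (by rw [hι, T_ι_freeσ, tot_νι])
      (by rw [E.τ_map, tot_νι, E.τ_comp, Category.assoc, T_ι_freeσ, tot_ννι,
        reassoc_of% E.νm_assoc])
  have h := Cell.tot_epi _ hΘ ((E.c₂ X.freeσ X.freeσ).comp (Cell.ofHom (X.freeMul hν)))
    (((Cell.ofHom (E.κ₂ X.freeVec X.freeVec)).comp (E.T.cell (Cell.ofHom (X.freeMul hν)))).comp
      X.freeσ) (by simp)
  simp only [Cell.tot_comp, tot_ofHom, E.τ_map] at h
  refine h ?_
  have h2 := T_Ψ_freeMul (X := X) hν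
  rw [reassoc_of% e1, c₂_νι_freeMul, e0, Category.assoc, reassoc_of% h2, T_ι_freeσ, tot_νι]

lemma freeσ_one : (E.toComp.unitCell (E.m X.pt)).tot ≫ gl X.freeOne =
    (gl (E.κ₀ (E.T₀.obj X.pt)) ≫ E.τ (gl X.freeOne)) ≫ X.freeσ.tot := by
  rw [unitCell_freeOne, gl_freeOne, ← Category.assoc (gl (E.κ₀ X.pt)), ← tot_Tone, E.τ_comp,
    Category.assoc, Category.assoc, T_ι_freeσ, tot_νι]

lemma νe_freeσ : (E.νe X.freeVec).tot ≫ X.freeσ.tot = 𝟙 _ := by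
  refine Cell.tot_epi X.ι X.ι_invertible ((E.νe X.freeVec).comp X.freeσ) (Cell.id _)
    (E.T₀.left_unit X.pt) ?_
  rw [Cell.tot_comp, reassoc_of% E.νe_nat X.ι, T_ι_freeσ, reassoc_of% E.νe_νm]
  exact (Category.comp_id _).symm

lemma νm_freeσ : (E.νm X.freeVec).tot ≫ X.freeσ.tot = E.τ X.freeσ.tot ≫ X.freeσ.tot := by
  let TTι : Cell (𝟙 _) _ (E.T.obj (E.T.obj (E.T.obj X.vec))) (E.T.obj (E.T.obj X.freeVec)) :=
    (E.T.cell (E.T.cell X.ι)).copy (by simp) rfl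
  have hι : TTι.tot = E.τ (E.τ X.ι.tot) := Cell.tot_copy _ _ _
  have hΘ : TTι.Invertible := Cell.Invertible.copy
    (E.T.cell_invertible _ (E.T.cell_invertible _ X.ι_invertible)) _ _
  refine Cell.tot_epi TTι hΘ ((E.νm X.freeVec).comp X.freeσ) ((E.T.cell X.freeσ).comp X.freeσ)
    (E.T₀.assoc X.pt).symm ?_
  rw [Cell.tot_comp, Cell.tot_comp, hι, reassoc_of% E.νm_nat X.ι, T_ι_freeσ, E.τ_map,
    ← E.τ_comp_assoc, T_ι_freeσ, E.τ_comp_assoc, T_ι_freeσ, reassoc_of% E.νm_assoc]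

/-- The structure homomorphism of the free `T`-algebra, with scalar `m_x`. -/
@[reducible]
noncomputable def freeAlgHom : E.monObj (X.free hν) ⟶ X.free hν where
  hom := E.m X.pt
  cell := X.freeσ
  mul_comm := (X.freeσ_mul hν).trans (congrArg (· ≫ _) (E.gl_monObj_mul (X.free hν)).symm)
  one_comm := X.freeσ_one.trans (congrArg (· ≫ _) (E.gl_monObj_one (X.free hν)).symm)

/-- The free `T`-algebra on a `T`-monoid. -/
@[reducible]
noncomputable def freeAlg : E.TAlgebra where
  A := X.free hν
  a := X.freeAlgHom hν
  unit := Mon.hom_ext X.νe_freeσ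
  assoc := Mon.hom_ext X.νm_freeσ

end

section
variable {X Y : TMon E} (F : X ⟶ Y) (hν : E.MulInvertible)

lemma τ_hom {X Y : TMon E} (F : X ⟶ Y) : (E.c₂ (E.T.cell F.cell) (E.T.cell (E.T.cell F.cell))).tot ≫
    gl (E.κ₂ Y.vec (E.T.obj Y.vec)) ≫ E.τ Y.mul.tot =
      gl (E.κ₂ _ _) ≫ E.τ X.mul.tot ≫ E.τ F.cell.tot := by
  have h := E.κ₂_natural F.cell (E.T.cell F.cell)
  rw [reassoc_of% h, ← E.τ_comp, ← E.τ_comp, F.mul_comm]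

/-- The cell from `m_x (T a)` to `m_y (T b)` induced by `T φ`, for a homomorphism `(f, φ)`. -/
noncomputable def freeCell : Cell (E.T₀.map F.hom) (E.T₀.map F.hom) X.freeVec Y.freeVec :=
  Cell.desc X.ι X.ι_invertible (((E.T.cell F.cell).comp Y.ι).copy (Category.comp_id _) rfl)
    (E.T₀.map F.hom) (E.T₀.μ.naturality F.hom).symm

lemma ι_freeCell : X.ι.tot ≫ (freeCell F).tot = E.τ F.cell.tot ≫ Y.ι.tot := by
  rw [freeCell, Cell.tot_desc, Cell.tot_copy]; rfl

lemma νι_freeCell : X.νι.tot ≫ (freeCell F).tot = E.τ (E.τ F.cell.tot) ≫ Y.νι.tot := by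
  rw [tot_νι, tot_νι, Category.assoc, ι_freeCell, reassoc_of% E.νm_nat F.cell]

lemma freeCell_mul : (E.c₂ (freeCell F) (freeCell F)).tot ≫ gl (Y.freeMul hν) =
    gl (X.freeMul hν) ≫ (freeCell F).tot := by
  have e1 : (E.c₂ X.ι X.νι).tot ≫ (E.c₂ (freeCell F) (freeCell F)).tot =
      (E.c₂ ((E.T.cell F.cell).comp Y.ι) ((E.T.cell (E.T.cell F.cell)).comp Y.νι)).tot :=
    E.c₂_comp (ι_freeCell F) (νι_freeCell F)
  have e2 : (E.c₂ (E.T.cell F.cell) (E.T.cell (E.T.cell F.cell))).tot ≫ (E.c₂ Y.ι Y.νι).tot =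
      (E.c₂ ((E.T.cell F.cell).comp Y.ι) ((E.T.cell (E.T.cell F.cell)).comp Y.νι)).tot :=
    E.c₂_comp (Cell.tot_comp _ _).symm (Cell.tot_comp _ _).symm
  have h := Cell.tot_epi _ (X.Ψ_invertible hν)
    ((E.c₂ (freeCell F) (freeCell F)).comp (Cell.ofHom (Y.freeMul hν)))
    ((Cell.ofHom (X.freeMul hν)).comp (freeCell F)) (by simp)
  simp only [Cell.tot_comp, tot_ofHom] at h
  refine h ?_
  have e3 := X.Ψ_freeMul hν
  rw [reassoc_of% e3, ι_freeCell, Ψ, reassoc_of% e1, ← e2, Category.assoc, c₂_freeMul]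
  have e4 := τ_hom F
  rw [reassoc_of% e4]

lemma freeCell_one : (E.toComp.unitCell (E.T₀.map F.hom)).tot ≫ gl Y.freeOne =
    gl X.freeOne ≫ (freeCell F).tot := by
  have h := E.κ₀_natural F.hom
  rw [gl_freeOne, gl_freeOne, reassoc_of% h, ← E.τ_comp_assoc, F.one_comm, E.τ_comp_assoc,
    Category.assoc, Category.assoc, ι_freeCell]

lemma freeCell_σ : E.τ (freeCell F).tot ≫ Y.freeσ.tot = X.freeσ.tot ≫ (freeCell F).tot := by
  refine T_ι_epi ((E.T.cell (freeCell F)).comp Y.freeσ) (X.freeσ.comp (freeCell F))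
    (E.T₀.μ.naturality F.hom) ?_
  have e1 := X.T_ι_freeσ
  rw [Cell.tot_comp, Cell.tot_comp, E.τ_map, reassoc_of% e1, ← E.τ_comp_assoc, ι_freeCell,
    E.τ_comp_assoc, T_ι_freeσ, reassoc_of% E.νm_nat F.cell]

/-- The monoid homomorphism between free `T`-algebras induced by a homomorphism of `T`-monoids. -/
@[reducible]
noncomputable def freeHom : X.free hν ⟶ Y.free hν where
  hom := E.T₀.map F.hom
  cell := freeCell F
  mul_comm := freeCell_mul F hν
  one_comm := freeCell_one F

/-- The homomorphism of free `T`-algebras induced by a homomorphism of `T`-monoids. -/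
@[reducible]
noncomputable def freeHomAlg : X.freeAlg hν ⟶ Y.freeAlg hν where
  f := freeHom F hν
  h := Mon.hom_ext (freeCell_σ F)

lemma freeCell_id (X : TMon E) : (freeCell (𝟙 X)).tot = 𝟙 _ :=
  Cell.tot_epi X.ι X.ι_invertible _ (Cell.id _) (E.T₀.map_id _) <| by
    rw [ι_freeCell, id_tot, E.τ_id]
    exact (Category.id_comp _).trans (Category.comp_id _).symm

lemma freeCell_comp {X Y Z : TMon E} (F : X ⟶ Y) (G : Y ⟶ Z) :
    (freeCell (F ≫ G)).tot = (freeCell F).tot ≫ (freeCell G).tot :=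
  Cell.tot_epi X.ι X.ι_invertible _ ((freeCell F).comp (freeCell G)) (E.T₀.map_comp _ _) <| by
    have h := ι_freeCell F
    rw [ι_freeCell, comp_tot, E.τ_comp, Cell.tot_comp, reassoc_of% h, ι_freeCell,
      Category.assoc]

end
end TMon

/-- The free `T`-algebra functor, `(x, a) ↦ (T x, m_x (T a))`. -/
@[reducible]
noncomputable def freeTAlgebra (E : TEquipment.{v₁, u₁} C) (hν : E.MulInvertible) :
    TMon E ⥤ E.TAlgebra where
  obj X := X.freeAlg hν
  map F := TMon.freeHomAlg F hν
  map_id X := Monad.Algebra.Hom.ext (Mon.hom_ext (TMon.freeCell_id X))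
  map_comp F G := Monad.Algebra.Hom.ext (Mon.hom_ext (TMon.freeCell_comp F G))

namespace TAlg
variable {E : TStarEquipment.{v₁, u₁} C} (Y : E.TAlgebra)

/-- The object underlying a `T`-algebra. -/
abbrev pt : C := Y.A.pt
/-- The vector `b` underlying a `T`-algebra. -/
abbrev vec : Vec E.mod (pt Y) (pt Y) := Y.A.vec
/-- The scalar part `h : T x ⟶ x` of the algebra structure. -/
@[reducible]
def h : E.T₀.obj (pt Y) ⟶ pt Y := Y.a.hom
/-- The cell part of the algebra structure. -/
@[reducible]
def σ : Cell (h Y) (h Y) (E.T.obj (vec Y)) (vec Y) := Y.a.cell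

lemma νe_σ : (E.νe (vec Y)).tot ≫ (σ Y).tot = 𝟙 _ :=
  congrArg (fun F : Y.A ⟶ Y.A => F.cell.tot) Y.unit
lemma νm_σ : (E.νm (vec Y)).tot ≫ (σ Y).tot = E.τ (σ Y).tot ≫ (σ Y).tot :=
  congrArg (fun F : E.monObj (E.monObj Y.A) ⟶ Y.A => F.cell.tot) Y.assoc
lemma e_h : E.e (pt Y) ≫ h Y = 𝟙 _ := congrArg (fun F : Y.A ⟶ Y.A => F.hom) Y.unit
lemma m_h : E.m (pt Y) ≫ h Y = E.T₀.map (h Y) ≫ h Y :=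
  congrArg (fun F : E.monObj (E.monObj Y.A) ⟶ Y.A => F.hom) Y.assoc
lemma σ_mul : (E.c₂ (σ Y) (σ Y)).tot ≫ gl Y.A.mul =
    (gl (E.κ₂ (vec Y) (vec Y)) ≫ E.τ (gl Y.A.mul)) ≫ (σ Y).tot :=
  Y.a.mul_comm.trans (congrArg (· ≫ _) (E.gl_monObj_mul Y.A))
lemma σ_one : (E.toComp.unitCell (h Y)).tot ≫ gl Y.A.one =
    (gl (E.κ₀ (pt Y)) ≫ E.τ (gl Y.A.one)) ≫ (σ Y).tot :=
  Y.a.one_comm.trans (congrArg (· ≫ _) (E.gl_monObj_one Y.A))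

/-- The vector `h^* b : x ⇸ T x`. -/
@[reducible]
def undVec : Vec E.mod (pt Y) (E.T₀.obj (pt Y)) := (E.star.copost _ (h Y)).obj (vec Y)

/-- The universal cell from `h^* b` to `b`. -/
@[reducible]
def c : Cell (𝟙 (pt Y)) (h Y) (undVec Y) (vec Y) := E.star.starCell (h Y) (vec Y)

/-- The cell `T c` followed by `σ`, from `T (h^* b)` to `b`. -/
def cσ : Cell (h Y) (E.T₀.map (h Y) ≫ h Y) (E.T.obj (undVec Y)) (vec Y) :=
  ((E.T.cell (c Y)).comp (σ Y)).copy (by simp) rfl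

lemma tot_cσ : (cσ Y).tot = E.τ (c Y).tot ≫ (σ Y).tot := Cell.tot_copy _ _ _

/-- The horizontal composite of `c` and `cσ`, followed by the multiplication of `b`. -/
def preMul : Cell (𝟙 (pt Y)) (E.T₀.map (h Y) ≫ h Y) (E.P₂ (undVec Y) (E.T.obj (undVec Y)))
    (vec Y) :=
  ((E.c₂ (c Y) (cσ Y)).comp (Cell.ofHom Y.A.mul)).copy (Category.comp_id _) (Category.comp_id _)

lemma tot_preMul : (preMul Y).tot = (E.c₂ (c Y) (cσ Y)).tot ≫ gl Y.A.mul := Cell.tot_copy _ _ _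

/-- The multiplication of the `T`-monoid `(x, h^* b)`: the mate of `preMul` for the factorization
`T h ≫ h = m_x ≫ h`. -/
noncomputable def undMul : Cell (𝟙 (pt Y)) (E.m (pt Y)) (E.P₂ (undVec Y) (E.T.obj (undVec Y)))
    (undVec Y) :=
  E.star.starLift (preMul Y) (E.m (pt Y)) (h Y) (m_h Y)

lemma undMul_c : (undMul Y).tot ≫ (c Y).tot = (E.c₂ (c Y) (cσ Y)).tot ≫ gl Y.A.mul :=
  (E.star.tot_starLift (preMul Y) (m_h Y)).trans (tot_preMul Y)

/-- The unit of the `T`-monoid `(x, h^* b)`: the mate of the unit of `b` for the factorization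
`𝟙 x = e_x ≫ h`. -/
noncomputable def undOne : Cell (𝟙 (pt Y)) (E.e (pt Y)) (E.i (pt Y)) (undVec Y) :=
  E.star.starLift (Cell.ofHom Y.A.one) (E.e (pt Y)) (h Y) (e_h Y)

lemma undOne_c : (undOne Y).tot ≫ (c Y).tot = gl Y.A.one :=
  E.star.tot_starLift (Cell.ofHom Y.A.one) (e_h Y)

variable {Y}
lemma c_mono {x y : C} {d : Vec E.mod x y} {f f' : _} {g g' : _} (φ : Cell f g d (undVec Y))
    (φ' : Cell f' g' d (undVec Y)) (hg : g = g')
    (H : φ.tot ≫ (c Y).tot = φ'.tot ≫ (c Y).tot) : φ.tot = φ'.tot :=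
  E.star.starCell_mono φ φ' hg H

variable (Y)

/-- The cell `T T c` followed by `T σ` and `σ`. -/
def cσσ : Cell (E.T₀.map (h Y) ≫ h Y) (E.T₀.map (E.T₀.map (h Y)) ≫ E.T₀.map (h Y) ≫ h Y)
    (E.T.obj (E.T.obj (undVec Y))) (vec Y) :=
  ((E.T.cell (E.T.cell (c Y))).comp ((E.T.cell (σ Y)).comp (σ Y))).copy (by simp) rfl

lemma tot_cσσ : (cσσ Y).tot = E.τ (E.τ (c Y).tot) ≫ E.τ (σ Y).tot ≫ (σ Y).tot :=
  Cell.tot_copy _ _ _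

/-- The cell `κ₂` followed by the image under `T` of the multiplication of `h^* b`. -/
noncomputable def undTmul : Cell (𝟙 (E.T₀.obj (pt Y))) (E.T₀.map (E.m (pt Y)))
    (E.P₂ (E.T.obj (undVec Y)) (E.T.obj (E.T.obj (undVec Y)))) (E.T.obj (undVec Y)) :=
  ((Cell.ofHom (E.κ₂ (undVec Y) (E.T.obj (undVec Y)))).comp (E.T.cell (undMul Y))).copy
    (by simp) (by simp)

lemma tot_undTmul : (undTmul Y).tot = gl (E.κ₂ _ _) ≫ E.τ (undMul Y).tot := Cell.tot_copy _ _ _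

/-- The cell `κ₀` followed by the image under `T` of the unit of `h^* b`. -/
noncomputable def undTone : Cell (𝟙 (E.T₀.obj (pt Y))) (E.T₀.map (E.e (pt Y)))
    (E.i (E.T₀.obj (pt Y))) (E.T.obj (undVec Y)) :=
  ((Cell.ofHom (E.κ₀ _)).comp (E.T.cell (undOne Y))).copy (by simp) (by simp)

lemma tot_undTone : (undTone Y).tot = gl (E.κ₀ _) ≫ E.τ (undOne Y).tot := Cell.tot_copy _ _ _

lemma undTmul_cσ : (undTmul Y).tot ≫ (cσ Y).tot = (E.c₂ (cσ Y) (cσσ Y)).tot ≫ gl Y.A.mul := by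
  have e1 : (E.c₂ (E.T.cell (c Y)) (E.T.cell (cσ Y))).tot ≫ (E.c₂ (σ Y) (σ Y)).tot =
      (E.c₂ (cσ Y) (cσσ Y)).tot :=
    E.c₂_comp (tot_cσ Y).symm (by rw [E.τ_map, tot_cσ, tot_cσσ, E.τ_comp, Category.assoc])
  have e2 := E.κ₂_natural (c Y) (cσ Y)
  rw [tot_undTmul, tot_cσ, Category.assoc, ← E.τ_comp_assoc, undMul_c, E.τ_comp_assoc,
    ← e1, Category.assoc, σ_mul, Category.assoc, reassoc_of% e2]

lemma undTone_cσ : (undTone Y).tot ≫ (cσ Y).tot = (E.toComp.unitCell (h Y)).tot ≫ gl Y.A.one := by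
  rw [tot_undTone, tot_cσ, Category.assoc, ← E.τ_comp_assoc, undOne_c, σ_one, Category.assoc]

/-- The underlying `T`-monoid `(x, h^* b)` of a `T`-algebra `(x, b, h, σ)`. -/
@[reducible]
noncomputable def und : TMon E.toTEquipment where
  pt := pt Y
  vec := undVec Y
  mul := undMul Y
  one := undOne Y
  assoc := by
    refine c_mono ((Cell.ofHom (E.ξ₂₁ (undVec Y) (E.T.obj (undVec Y))
        (E.T.obj (E.T.obj (undVec Y))))).comp
        ((E.c₂ (undMul Y) (E.νm (undVec Y))).comp (undMul Y)))
      ((Cell.ofHom (E.ξ₁₂ (undVec Y) (E.T.obj (undVec Y))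
        (E.T.obj (E.T.obj (undVec Y))))).comp
        ((E.c₂ (Cell.id (undVec Y)) (undTmul Y)).comp (undMul Y)))
      (congrArg (𝟙 _ ≫ ·) (E.T₀.assoc (pt Y)).symm) ?_
    simp only [Cell.tot_comp, tot_ofHom, Category.assoc, undMul_c]
    have e1 : (E.c₂ (undMul Y) (E.νm (undVec Y))).tot ≫ (E.c₂ (c Y) (cσ Y)).tot =
        (E.c₂ (preMul Y) (cσσ Y)).tot :=
      E.c₂_comp (by rw [undMul_c, tot_preMul])
        (by rw [tot_cσ, ← reassoc_of% E.νm_nat (c Y), νm_σ, tot_cσσ])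
    have e2 : (E.c₂ (E.c₂ (c Y) (cσ Y)) (cσσ Y)).tot ≫
        (E.c₂ (Cell.ofHom Y.A.mul) (Cell.id (vec Y))).tot = (E.c₂ (preMul Y) (cσσ Y)).tot :=
      E.c₂_comp (by rw [tot_ofHom, tot_preMul]) (Category.comp_id _)
    let R : Cell (h Y) _ _ (vec Y) := ((E.c₂ (cσ Y) (cσσ Y)).comp (Cell.ofHom Y.A.mul)).copy
      (Category.comp_id _) rfl
    have hR : R.tot = (E.c₂ (cσ Y) (cσσ Y)).tot ≫ gl Y.A.mul := Cell.tot_copy _ _ _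
    have f1 : (E.c₂ (Cell.id (undVec Y)) (undTmul Y)).tot ≫ (E.c₂ (c Y) (cσ Y)).tot =
        (E.c₂ (c Y) R).tot :=
      E.c₂_comp (Category.id_comp _) (by rw [hR, undTmul_cσ])
    have f2 : (E.c₂ (c Y) (E.c₂ (cσ Y) (cσσ Y))).tot ≫
        (E.c₂ (Cell.id (vec Y)) (Cell.ofHom Y.A.mul)).tot = (E.c₂ (c Y) R).tot :=
      E.c₂_comp (Category.comp_id _) hR.symm
    rw [reassoc_of% e1, reassoc_of% f1, ← e2, ← f2, Category.assoc, Category.assoc,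
      ← reassoc_of% E.ξ₂₁_natural, ← reassoc_of% E.ξ₁₂_natural]
    exact congrArg (_ ≫ ·) Y.A.assoc'
  one_mul := by
    refine c_mono ((Cell.ofHom (E.ξ₀₁ (undVec Y))).comp
        ((E.c₂ (undOne Y) (E.νe (undVec Y))).comp (undMul Y))) (Cell.id _)
      ((congrArg (𝟙 _ ≫ ·) (E.T₀.left_unit (pt Y))).trans (Category.id_comp _)) ?_
    simp only [Cell.tot_comp, tot_ofHom, Category.assoc, undMul_c]
    have e1 : (E.c₂ (undOne Y) (E.νe (undVec Y))).tot ≫ (E.c₂ (c Y) (cσ Y)).tot =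
        (E.c₂ (Cell.ofHom Y.A.one) (c Y)).tot :=
      E.c₂_comp (undOne_c Y)
        (by rw [tot_cσ, ← reassoc_of% E.νe_nat (c Y), νe_σ]; exact Category.comp_id _)
    have e2 : (E.c₂ (E.toComp.unitCell (𝟙 _)) (c Y)).tot ≫
        (E.c₂ (Cell.ofHom Y.A.one) (Cell.id (vec Y))).tot =
        (E.c₂ (Cell.ofHom Y.A.one) (c Y)).tot :=
      E.c₂_comp (by rw [E.unitCell_id, Category.id_comp]) (Category.comp_id _)
    rw [reassoc_of% e1, ← e2, Category.assoc, ← reassoc_of% E.ξ₀₁_natural]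
    exact (congrArg (_ ≫ ·) Y.A.one_mul').trans
      ((Category.comp_id _).trans (Category.id_comp _).symm)
  mul_one := by
    refine c_mono ((Cell.ofHom (E.ξ₁₀ (undVec Y))).comp
        ((E.c₂ (Cell.id _) (undTone Y)).comp (undMul Y))) (Cell.id _)
      ((congrArg (𝟙 _ ≫ ·) (E.T₀.right_unit (pt Y))).trans (Category.id_comp _)) ?_
    simp only [Cell.tot_comp, tot_ofHom, Category.assoc, undMul_c]
    let R : Cell (h Y) (h Y) _ (vec Y) := ((E.toComp.unitCell (h Y)).comp (Cell.ofHom Y.A.one)).copy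
      (Category.comp_id _) (Category.comp_id _)
    have hR : R.tot = (E.toComp.unitCell (h Y)).tot ≫ gl Y.A.one := Cell.tot_copy _ _ _
    have e1 : (E.c₂ (Cell.id _) (undTone Y)).tot ≫ (E.c₂ (c Y) (cσ Y)).tot =
        (E.c₂ (c Y) R).tot :=
      E.c₂_comp (Category.id_comp _) (by rw [undTone_cσ, hR])
    have e2 : (E.c₂ (c Y) (E.toComp.unitCell (h Y))).tot ≫
        (E.c₂ (Cell.id (vec Y)) (Cell.ofHom Y.A.one)).tot = (E.c₂ (c Y) R).tot :=
      E.c₂_comp (Category.comp_id _) hR.symm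
    rw [reassoc_of% e1, ← e2, Category.assoc, ← reassoc_of% E.ξ₁₀_natural]
    exact (congrArg (_ ≫ ·) Y.A.mul_one').trans
      ((Category.comp_id _).trans (Category.id_comp _).symm)

section
variable {Y Z : E.TAlgebra} (F : Y ⟶ Z)

lemma hom_σ {Y Z : E.TAlgebra} (F : Y ⟶ Z) :
    E.τ F.f.cell.tot ≫ (σ Z).tot = (σ Y).tot ≫ F.f.cell.tot :=
  congrArg (fun F : E.monObj Y.A ⟶ Z.A => F.cell.tot) F.h

lemma hom_h {Y Z : E.TAlgebra} (F : Y ⟶ Z) :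
    E.T₀.map F.f.hom ≫ h Z = h Y ≫ F.f.hom :=
  congrArg (fun F : E.monObj Y.A ⟶ Z.A => F.hom) F.h

/-- The cell from `h^* b` to `k^* d` that is the mate of `c` followed by `φ`, for a homomorphism
`(f, φ) : (x, b, h) ⟶ (y, d, k)` and the factorization `h ≫ f = T f ≫ k`. -/
noncomputable def undCell : Cell F.f.hom (E.T₀.map F.f.hom) (undVec Y) (undVec Z) :=
  E.star.starLift (((c Y).comp F.f.cell).copy (Category.id_comp _) rfl) (E.T₀.map F.f.hom) (h Z)
    (hom_h F)

lemma undCell_c : (undCell F).tot ≫ (c Z).tot = (c Y).tot ≫ F.f.cell.tot :=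
  (E.star.tot_starLift _ (hom_h F)).trans (Cell.tot_copy _ _ _)

/-- The homomorphism of underlying `T`-monoids. -/
@[reducible]
noncomputable def undHom : und Y ⟶ und Z where
  hom := F.f.hom
  cell := undCell F
  mul_comm := by
    refine c_mono ((E.c₂ (undCell F) (E.T.cell (undCell F))).comp (undMul Z))
      ((undMul Y).comp (undCell F)) (E.T₀.μ.naturality _) ?_
    let W : Cell (h Y ≫ F.f.hom) ((E.T₀.map (h Y) ≫ h Y) ≫ F.f.hom) (E.T.obj (undVec Y)) (vec Z) :=
      (cσ Y).comp F.f.cell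
    have e1 : (E.c₂ (undCell F) (E.T.cell (undCell F))).tot ≫ (E.c₂ (c Z) (cσ Z)).tot =
        (E.c₂ ((c Y).comp F.f.cell) ((cσ Y).comp F.f.cell)).tot :=
      E.c₂_comp (undCell_c F) (by
        rw [Cell.tot_comp, tot_cσ, tot_cσ, E.τ_map, ← E.τ_comp_assoc, undCell_c, E.τ_comp_assoc,
          hom_σ, Category.assoc])
    have e2 : (E.c₂ (c Y) (cσ Y)).tot ≫ (E.c₂ F.f.cell F.f.cell).tot =
        (E.c₂ ((c Y).comp F.f.cell) ((cσ Y).comp F.f.cell)).tot :=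
      E.c₂_comp rfl rfl
    have e3 := undMul_c Y
    rw [Cell.tot_comp, Cell.tot_comp, Category.assoc, Category.assoc, undMul_c, undCell_c,
      reassoc_of% e1, ← e2, reassoc_of% e3, Category.assoc]
    exact congrArg (_ ≫ ·) F.f.mul_comm
  one_comm := by
    refine c_mono ((E.toComp.unitCell F.f.hom).comp (undOne Z))
      ((undOne Y).comp (undCell F)) (E.T₀.η.naturality _) ?_
    have e3 := undOne_c Y
    rw [Cell.tot_comp, Cell.tot_comp, Category.assoc, Category.assoc, undOne_c, undCell_c,
      reassoc_of% e3]
    exact F.f.one_comm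

lemma undCell_id (Y : E.TAlgebra) : (undCell (𝟙 Y)).tot = 𝟙 _ :=
  c_mono _ (Cell.id _) (E.T₀.map_id _) <| by
    rw [undCell_c]; exact (Category.comp_id _).trans (Category.id_comp _).symm

lemma undCell_comp {X Y Z : E.TAlgebra} (F : X ⟶ Y) (G : Y ⟶ Z) :
    (undCell (F ≫ G)).tot = (undCell F).tot ≫ (undCell G).tot :=
  c_mono _ ((undCell F).comp (undCell G)) (E.T₀.map_comp _ _) <| by
    have h1 := undCell_c F
    rw [undCell_c, Cell.tot_comp, Category.assoc, undCell_c, reassoc_of% h1]; rfl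

end
end TAlg

/-- The underlying `T`-monoid functor, `(x, b, h, σ) ↦ (x, h^* b)`. -/
@[reducible]
noncomputable def underlyingTMonoid (E : TStarEquipment.{v₁, u₁} C) :
    E.TAlgebra ⥤ TMon E.toTEquipment where
  obj Y := TAlg.und Y
  map F := TAlg.undHom F
  map_id Y := TMon.hom_ext ((TAlg.undCell_id Y).trans (TMon.id_tot (TAlg.und Y)).symm)
  map_comp F G := TMon.hom_ext ((TAlg.undCell_comp F G).trans (TMon.comp_tot (TAlg.undHom F) (TAlg.undHom G)).symm)

/-- The cell of the unit at a `T`-monoid `(x, a)`, from `a` to `m_x^* (m_x (T a))` and with boundaries `e_x`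
and `T e_x`: it is the mate, for the factorization `e_{T x} ≫ m_x = T e_x ≫ m_x`, of the cell `νe_a` followed
by the cell from `T a` to `m_x (T a)`. -/
noncomputable def unitCell {E : TStarEquipment.{v₁, u₁} C} (X : TMon E.toTEquipment) :
    Cell (E.e X.pt) (E.T₀.map (E.e X.pt)) X.vec
      ((E.star.copost _ (E.m X.pt)).obj X.freeVec) :=
  E.star.starLift (((E.νe X.vec).comp X.ι).copy (Category.comp_id _)
      (E.T₀.left_unit X.pt)) (E.T₀.map (E.e X.pt)) (E.m X.pt)
    (E.T₀.right_unit X.pt)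

/-- The cell of the counit at a `T`-algebra `(x, b, h, σ)`, from `m_x T (h^* b)` to `b` and with boundaries
`h`, `h`: it is induced by `T c` followed by `σ` and the equation `T h ≫ h = m_x ≫ h`. -/
noncomputable def counitCell {E : TStarEquipment.{v₁, u₁} C} (Y : E.TAlgebra) :
    Cell (TAlg.h Y) (TAlg.h Y)
      ((act E.mod (post _ (E.m (TAlg.pt Y)))).obj (E.T.obj (TAlg.undVec Y))) (TAlg.vec Y) :=
  Cell.desc (Cell.pushCell _ (E.m (TAlg.pt Y))) (Cell.pushCell_invertible _ _) (TAlg.cσ Y)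
    (TAlg.h Y) (TAlg.m_h Y)

end TEq

/-! Both functors are built from cells with a universal property. The cell `ι` from `T a` to `m_x (T
a)` is invertible with identity left boundary, so a cell out of `m_x (T a)` is determined by its
composite with `ι`, once its right boundary is known (`Cell.tot_epi`). The cell `c` from `h^* b` to
`b` is the counit of the adjunction between `h` and `h^*`. Hence a cell into `h^* b` is determined
by its composite with `c`, again once its right boundary is known (`TAlg.c_mono`). The unit and the
counit are the solutions of `unit ≫ c = νe ≫ ι` and `ι ≫ counit = T c ≫ σ` (`unitCell_c`,
`ι_counitCell`), and everything about them is read off from these two equations.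

For a mathematician this is the usual proof that free algebras are free. After composing with `c`,
an equation about the unit becomes one about `νe ≫ ι`. It then follows from naturality of `νe`, from
its compatibility with `κ`, and from the unit laws of the monad on the equipment. After composing
with `ι`, an equation about the counit becomes one about `T c ≫ σ`. It then follows from naturality
of `νm` and from the fact that `σ` is a homomorphism of monoids satisfying the algebra laws. The two
triangle identities reduce to `T νe ≫ νm = 1` and to `νe ≫ σ = 1`.

The delicate points are the two multiplications (`unitCell_mul`, `counitCell_mul`), because the
product of the free algebra is known only after composing with `Ψ`, the horizontal composite of `ι`
and `νm ≫ ι`. Since `νm` is invertible, `Ψ` is invertible too and may be cancelled. For the unit,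
the relevant horizontal composite is made to factor through `Ψ` by inserting `νe ≫ νm = 1` in its
second factor. For the counit, `Ψ` is cancelled on the left.

Equations are stated in the category `Tot` of all cells, where a morphism includes its boundary
scalars. Cancelling `ι` or `c` therefore leaves an equation between right boundaries, which is
always an instance of a monad law, of an algebra law, or of naturality. -/

namespace TEq
variable {C : Type u} [Category.{v} C] {E : TStarEquipment.{v₁, u₁} C}

/-! ### The unit as a natural homomorphism of `T`-monoids -/

section UnitHom
variable (X : TMon E.toTEquipment) (hν : E.MulInvertible)

/-- This is the defining property of the mate: the scalar of the free algebra is `m_x`, so its cell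
`c` is the universal cell of `m_x^*`. By `TAlg.c_mono` the equation characterizes the unit among
cells with right boundary `T e_x`. -/
lemma unitCell_c :
    (unitCell X).tot ≫ (TAlg.c (X.freeAlg hν)).tot = (E.νe X.vec).tot ≫ X.ι.tot :=
  (E.star.tot_starLift _ (E.T₀.right_unit X.pt)).trans (Cell.tot_copy _ _ _)

/-- Applying `T` to the equation of the unit gives `T νe ≫ T ι ≫ σ`. On the free algebra `T ι ≫ σ`
is `νm ≫ ι`, and `T νe ≫ νm = 1`. The result is the second factor in the multiplicativity of the
unit and, later, the content of the first triangle identity. -/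
lemma T_unitCell_cσ :
    E.τ (unitCell X).tot ≫ (TAlg.cσ (X.freeAlg hν)).tot = X.ι.tot := by
  rw [TAlg.tot_cσ, ← E.τ_comp_assoc, unitCell_c, E.τ_comp_assoc]
  -- By definition the structure cell `σ` of the free algebra is `freeσ`, which `T ι` turns into `νm
  -- ≫ ι`.
  have h : E.τ X.ι.tot ≫ (TAlg.σ (X.freeAlg hν)).tot = _ := X.T_ι_freeσ
  rw [h, reassoc_of% E.T_νe_νm]

/-- After composing with `c`, the left side is the horizontal composite of `νe ≫ ι` and `ι`,
followed by the product of the free algebra. Factoring this composite through `Ψ` makes the product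
computable as `κ₂ ≫ T μ ≫ ι`. What remains is that `νe` respects `κ₂` and is natural with respect to
`μ`. -/
lemma unitCell_mul :
    (E.c₂ (unitCell X) (E.T.cell (unitCell X))).tot ≫ (TAlg.undMul (X.freeAlg hν)).tot =
      X.mul.tot ≫ (unitCell X).tot := by
  -- Composing with `c` records right boundaries only after a further `m_x`, so `T (T e_x) ≫ m_{T x}
  -- = m_x ≫ T e_x` has to be supplied separately. It is naturality of the multiplication at `e_x`.
  refine TAlg.c_mono (Y := X.freeAlg hν)
    ((E.c₂ (unitCell X) (E.T.cell (unitCell X))).comp (TAlg.undMul (X.freeAlg hν)))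
    (X.mul.comp (unitCell X)) (E.T₀.μ.naturality _) ?_
  -- The right boundary `e_{T x} ≫ m_x` is replaced by the identity, so that `νe ≫ ι` can be
  -- composed horizontally with `ι`, whose left boundary is an identity.
  let R : Cell (E.e X.pt) (𝟙 _) X.vec X.freeVec :=
    ((E.νe X.vec).comp X.ι).copy (Category.comp_id _) (E.T₀.left_unit X.pt)
  have hR : R.tot = (E.νe X.vec).tot ≫ X.ι.tot := Cell.tot_copy _ _ _
  have e1 : (E.c₂ (unitCell X) (E.T.cell (unitCell X))).tot ≫
      (E.c₂ (TAlg.c (X.freeAlg hν)) (TAlg.cσ (X.freeAlg hν))).tot = (E.c₂ R X.ι).tot :=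
    E.c₂_comp (by rw [unitCell_c, hR]) (T_unitCell_cσ X hν)
  -- The bare `ι` in the second factor is rewritten as `νe_{T a} ≫ νm_a ≫ ι`, by the left unit law.
  -- This produces the second factor of `Ψ`, and with it the defining equation of the product
  -- applies.
  have e2 : (E.c₂ (E.νe X.vec) (E.νe (E.T.obj X.vec))).tot ≫ (E.c₂ X.ι X.νι).tot =
      (E.c₂ R X.ι).tot :=
    E.c₂_comp hR.symm (by rw [X.tot_νι, reassoc_of% E.νe_νm])
  have e3 := E.νe_κ₂ X.vec (E.T.obj X.vec)
  have e4 : (E.c₂ X.ι X.νι).tot ≫ gl (X.freeAlg hν).A.mul = _ := X.c₂_freeMul hν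
  rw [Cell.tot_comp, Cell.tot_comp, Category.assoc, Category.assoc, TAlg.undMul_c, unitCell_c,
    reassoc_of% e1, ← e2, Category.assoc, e4, reassoc_of% e3, ← reassoc_of% E.νe_nat X.mul]

/-- Composed with `c`, both sides become cells out of the identity vector. The unit of the free
algebra is `κ₀ ≫ T η ≫ ι`, compatibility of `νe` with `κ₀` turns the scalar `e_x` on identity
vectors into `νe`, and naturality moves `νe` past `η`. The right boundaries agree by naturality of
`e` at `e_x`. -/
lemma unitCell_one :
    (E.toComp.unitCell (E.e X.pt)).tot ≫ (TAlg.undOne (X.freeAlg hν)).tot =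
      X.one.tot ≫ (unitCell X).tot := by
  refine TAlg.c_mono (Y := X.freeAlg hν)
    ((E.toComp.unitCell (E.e X.pt)).comp (TAlg.undOne (X.freeAlg hν)))
    (X.one.comp (unitCell X)) (E.T₀.η.naturality _) ?_
  have e1 : gl (X.freeAlg hν).A.one = _ := X.gl_freeOne
  have e2 := E.νe_κ₀ X.pt
  rw [Cell.tot_comp, Cell.tot_comp, Category.assoc, Category.assoc, TAlg.undOne_c, unitCell_c,
    e1, reassoc_of% e2, ← reassoc_of% E.νe_nat X.one]

/-- The unit `(e_x, φ_{e_x})` as a homomorphism of `T`-monoids. -/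
@[reducible]
noncomputable def unitHom : X ⟶ TAlg.und (X.freeAlg hν) where
  hom := E.e X.pt
  cell := unitCell X
  mul_comm := unitCell_mul X hν
  one_comm := unitCell_one X hν

/-- Composing with `c` replaces the unit by `νe ≫ ι` and the mate of the free homomorphism by that
homomorphism itself. Then `νe` is natural with respect to the cell of `F`, and `ι` intertwines its
image under `T` with `freeCell F`. -/
lemma unitHom_naturality {X Y : TMon E.toTEquipment} (F : X ⟶ Y) :
    F.cell.tot ≫ (unitCell Y).tot =
      (unitCell X).tot ≫ (TAlg.undCell (TMon.freeHomAlg F hν)).tot := by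
  -- The right boundaries agree by the image under `T` of the naturality of `e` at the scalar of
  -- `F`.
  refine TAlg.c_mono (Y := Y.freeAlg hν) (F.cell.comp (unitCell Y))
    ((unitCell X).comp (TAlg.undCell (TMon.freeHomAlg F hν)))
    ((E.T₀.map_comp _ _).symm.trans ((congrArg E.T₀.map (E.T₀.η.naturality F.hom)).trans
      (E.T₀.map_comp _ _))) ?_
  have e1 := unitCell_c X hν
  rw [Cell.tot_comp, Cell.tot_comp, Category.assoc, Category.assoc, unitCell_c, TAlg.undCell_c,
    reassoc_of% e1, reassoc_of% E.νe_nat F.cell]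
  exact congrArg (_ ≫ ·) (TMon.ι_freeCell F).symm

end UnitHom

/-! ### The counit as a natural homomorphism of `T`-algebras -/

section CounitHom
variable (Y : E.TAlgebra) (hν : E.MulInvertible)

/-- The counit is by definition the factorization of `T c ≫ σ` through `ι`. Together with
`Cell.tot_epi` this is all that is used about it. -/
lemma ι_counitCell : (TAlg.und Y).ι.tot ≫ (counitCell Y).tot = (TAlg.cσ Y).tot :=
  Cell.tot_desc _ _ _ _ _

/-- Naturality of `νm` at `c` moves it next to `σ`, where the associativity law of the algebra
replaces `νm ≫ σ` by `T σ ≫ σ`. -/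
lemma νm_cσ : (E.νm (TAlg.undVec Y)).tot ≫ (TAlg.cσ Y).tot = (TAlg.cσσ Y).tot := by
  rw [TAlg.tot_cσ, ← reassoc_of% E.νm_nat (TAlg.c Y), TAlg.νm_σ, TAlg.tot_cσσ]

/-- The second factor of `Ψ` is `νm ≫ ι`. This evaluates the counit on it, as `ι_counitCell` does on
the first factor. -/
lemma νι_counitCell : (TAlg.und Y).νι.tot ≫ (counitCell Y).tot = (TAlg.cσσ Y).tot := by
  rw [TMon.tot_νι, Category.assoc, ι_counitCell]
  exact νm_cσ Y

/-- The product of the free algebra is accessible only through `Ψ`, which can be cancelled because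
invertibility of `νm` makes it invertible. On `Ψ` the two copies of the counit become `T c ≫ σ` and
`T T c ≫ T σ ≫ σ`. On the other side `κ₂ ≫ T μ ≫ ι` appears, with `μ` the multiplication of `h^* b`.
The two sides agree because `σ` respects multiplication. -/
lemma counitCell_mul : (E.c₂ (counitCell Y) (counitCell Y)).tot ≫ gl Y.A.mul =
    gl ((TAlg.und Y).freeMul hν) ≫ (counitCell Y).tot := by
  refine Cell.tot_epi _ ((TAlg.und Y).Ψ_invertible hν)
    ((E.c₂ (counitCell Y) (counitCell Y)).comp (Cell.ofHom Y.A.mul))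
    ((Cell.ofHom ((TAlg.und Y).freeMul hν)).comp (counitCell Y)) (by simp) ?_
  have e1 : (TAlg.und Y).Ψ.tot ≫ (E.c₂ (counitCell Y) (counitCell Y)).tot =
      (E.c₂ (TAlg.cσ Y) (TAlg.cσσ Y)).tot :=
    E.c₂_comp (ι_counitCell Y) (νι_counitCell Y)
  have e2 := (TAlg.und Y).Ψ_freeMul hν
  -- Here multiplicativity of `σ` enters, combined with the image under `T` of the equation defining
  -- the multiplication of `h^* b` as a mate.
  have e3 := TAlg.undTmul_cσ Y
  rw [TAlg.tot_undTmul, Category.assoc] at e3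
  rw [Cell.tot_comp, Cell.tot_comp, tot_ofHom, tot_ofHom, reassoc_of% e1, reassoc_of% e2,
    ι_counitCell, ← e3]

/-- Unlike the product, the unit of the free algebra is given outright as `κ₀ ≫ T η ≫ ι`, so nothing
has to be cancelled. The equation is preservation of units by `σ`, in the form `TAlg.undTone_cσ`. -/
lemma counitCell_one : (E.toComp.unitCell (TAlg.h Y)).tot ≫ gl Y.A.one =
    gl (TAlg.und Y).freeOne ≫ (counitCell Y).tot := by
  have e3 := TAlg.undTone_cσ Y
  rw [TAlg.tot_undTone, Category.assoc] at e3
  rw [TMon.gl_freeOne, Category.assoc, Category.assoc, ι_counitCell, ← e3]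

/-- `T` preserves invertible cells, so `T ι` can be cancelled. One side then becomes `T (T c ≫ σ) ≫
σ`, the other `νm ≫ T c ≫ σ`, and both equal `T T c ≫ T σ ≫ σ` by the associativity law of the
algebra. -/
lemma counitCell_σ : E.τ (counitCell Y).tot ≫ (TAlg.σ Y).tot =
    (TAlg.und Y).freeσ.tot ≫ (counitCell Y).tot := by
  -- The equation of right boundaries is the scalar part of that law, `T h ≫ h = m_x ≫ h`.
  refine TMon.T_ι_epi ((E.T.cell (counitCell Y)).comp (TAlg.σ Y))
    ((TAlg.und Y).freeσ.comp (counitCell Y)) (TAlg.m_h Y).symm ?_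
  have e1 := (TAlg.und Y).T_ι_freeσ
  rw [Cell.tot_comp, Cell.tot_comp, E.τ_map, reassoc_of% e1, ← E.τ_comp_assoc, ι_counitCell]
  refine Eq.trans ?_ (νm_cσ Y).symm
  rw [TAlg.tot_cσ, TAlg.tot_cσσ, E.τ_comp_assoc]

/-- The counit `(h, φ_h)` as a homomorphism of `T`-algebras. -/
@[reducible]
noncomputable def counitHom : (TAlg.und Y).freeAlg hν ⟶ Y where
  f :=
    { hom := TAlg.h Y
      cell := counitCell Y
      mul_comm := counitCell_mul Y hν
      one_comm := counitCell_one Y }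
  h := Mon.hom_ext (counitCell_σ Y)

/-- Cancelling `ι` leaves `T` of the mate `undCell F`, followed by `T c ≫ σ` for `Z`. The equation
of the mate moves `F` past `T c`, and `F` passes `σ` because it is a homomorphism of algebras. The
scalar part of the same fact equates the right boundaries. -/
lemma counitHom_naturality {Y Z : E.TAlgebra} (F : Y ⟶ Z) :
    (TMon.freeCell (TAlg.undHom F)).tot ≫ (counitCell Z).tot =
      (counitCell Y).tot ≫ F.f.cell.tot := by
  refine Cell.tot_epi (TAlg.und Y).ι (TAlg.und Y).ι_invertible
    ((TMon.freeCell (TAlg.undHom F)).comp (counitCell Z))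
    ((counitCell Y).comp F.f.cell) (TAlg.hom_h F) ?_
  have e1 := TMon.ι_freeCell (TAlg.undHom F)
  have e2 := ι_counitCell Y
  rw [Cell.tot_comp, Cell.tot_comp, reassoc_of% e1, reassoc_of% e2, ι_counitCell, TAlg.tot_cσ,
    TAlg.tot_cσ, ← E.τ_comp_assoc, TAlg.undCell_c, E.τ_comp_assoc, TAlg.hom_σ, Category.assoc]

end CounitHom

/-! ### The triangle identities and the adjunction -/

section Triangles
variable (hν : E.MulInvertible)

/-- Precomposed with `ι`, the composite is `T` of the unit followed by `T c ≫ σ` of the free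
algebra. `T_unitCell_cσ` evaluates this to `ι`, so the identity rests on `T νe ≫ νm = 1`. The scalar
part is the corresponding law `T e_x ≫ m_x = 1`. -/
lemma freeCell_unit_counit (X : TMon E.toTEquipment) :
    (TMon.freeCell (unitHom X hν)).tot ≫ (counitCell (X.freeAlg hν)).tot = 𝟙 _ := by
  refine Cell.tot_epi X.ι X.ι_invertible
    ((TMon.freeCell (unitHom X hν)).comp (counitCell (X.freeAlg hν))) (Cell.id _)
    (E.T₀.right_unit X.pt) ?_
  have e1 := TMon.ι_freeCell (unitHom X hν)
  rw [Cell.tot_comp, reassoc_of% e1, ι_counitCell, T_unitCell_cσ]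
  exact (Category.comp_id _).symm

/-- Followed by `c`, the mate of the counit becomes `c ≫ counit`. The composite is therefore `νe ≫ ι
≫ counit`, that is `νe ≫ T c ≫ σ`. By naturality this equals `c ≫ νe ≫ σ`, and `νe ≫ σ = 1` is the
unit law of the algebra. -/
lemma unit_undCell_counit (Y : E.TAlgebra) :
    (unitCell (TAlg.und Y)).tot ≫ (TAlg.undCell (counitHom Y hν)).tot = 𝟙 _ := by
  -- The right boundary is `T e_x ≫ T h`, an identity because `e_x ≫ h = 1`.
  refine TAlg.c_mono ((unitCell (TAlg.und Y)).comp (TAlg.undCell (counitHom Y hν)))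
    (Cell.id _) ((E.T₀.map_comp _ _).symm.trans ((congrArg E.T₀.map (TAlg.e_h Y)).trans
      (E.T₀.map_id _))) ?_
  have e1 := unitCell_c (TAlg.und Y) hν
  rw [Cell.tot_comp, Category.assoc, TAlg.undCell_c, reassoc_of% e1, ι_counitCell, TAlg.tot_cσ,
    ← reassoc_of% E.νe_nat (TAlg.c Y), TAlg.νe_σ]
  exact (Category.comp_id _).trans (Category.id_comp _).symm

end Triangles

/-- The adjunction between the free `T`-algebra and the underlying `T`-monoid functors. -/
@[reducible]
noncomputable def freeUnderlyingAdjunction (E : TStarEquipment.{v₁, u₁} C)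
    (hν : E.MulInvertible) : freeTAlgebra E.toTEquipment hν ⊣ underlyingTMonoid E where
  unit :=
    { app X := unitHom X hν
      naturality X Y F := TMon.hom_ext <| by
        -- A composite of `T`-monoid homomorphisms has right boundary `T (f ≫ g)`, a composite of
        -- cells has `T f ≫ T g`. `TMon.comp_tot` identifies the two in `Tot`. For algebras the
        -- boundaries compose strictly, so naturality of the counit needs no such adjustment.
        refine (TMon.comp_tot F (unitHom Y hν)).trans ((unitHom_naturality hν F).trans ?_)
        exact (TMon.comp_tot (unitHom X hν) (TAlg.undHom (TMon.freeHomAlg F hν))).symm }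
  counit :=
    { app Y := counitHom Y hν
      naturality Y Z F := Monad.Algebra.Hom.ext (Mon.hom_ext (counitHom_naturality F)) }
  left_triangle_components X :=
    Monad.Algebra.Hom.ext (Mon.hom_ext (freeCell_unit_counit hν X))
  right_triangle_components Y := TMon.hom_ext <|
    (TMon.comp_tot (unitHom (TAlg.und Y) hν) (TAlg.undHom (counitHom Y hν))).trans
      ((unit_undCell_counit hν Y).trans (TMon.id_tot (TAlg.und Y)).symm)

end TEq

/-- Equality in `Tot` includes the boundary scalars, and a homomorphism is determined by its cell.
The two clauses therefore fix the unit and counit completely, with scalars `e_x` and `h`. They hold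
by definition, since the adjunction is built from these cells. -/
theorem mainTheorem1 {C : Type u} [Category.{v} C] (E : TEq.TStarEquipment.{v₁, u₁} C)
    (hν : E.MulInvertible) :
    ∃ adj : TEq.freeTAlgebra E.toTEquipment hν ⊣ TEq.underlyingTMonoid E,
      (∀ X : TEq.TMon E.toTEquipment, (adj.unit.app X).cell.tot = (TEq.unitCell X).tot) ∧
      (∀ Y : E.TAlgebra, (adj.counit.app Y).f.cell.tot = (TEq.counitCell Y).tot) :=
  ⟨TEq.freeUnderlyingAdjunction E hν, fun _ => rfl, fun _ => rfl⟩
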